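/- **Setting.** Let $(\Lambda_L)_{L\in\mathbb N}$ be a sequence of finite connected graphs with graph distance $\mathrm{dist}$, of uniformly finite dimension: there are constants $c,d$ independent of $L$ such that every ball of radius $r\in\mathbb N$ in $\Lambda_L$ has at most $c(1+r)^d$ vertices. Consider on each $\Lambda_L$ either a spin system, with Hilbert space $\bigotimes_{x\in\Lambda_L}\mathbb C^n$, or a system of fermions with $f$ flavours per site, with the fermionic Fock space generated by $c^{*}_{x,\alpha}$, $x\in\Lambda_L$, $1\le\alpha\le f$ ($n$, resp. $f$, independent of $L$). An operator is supported in $S\subset\Lambda_L$ if, for spins, it is of the form $O_S\otimes 1_{S^c}$ and, for fermions, it lies in the linear span of the monomials of even degree in $c_{x,\alpha},c^{*}_{x,\alpha}$ with $x\in S$. Write $S_{(r)}=\{x:\mathrm{dist}(x,S)\le r\}$. Let $H_L=\sum_{Z\subset\Lambda_L}h_{L,Z}$ be self-adjoint, where $h_{L,Z}$ is supported in $Z$, $h_{L,Z}=0$ unless $\mathrm{diam}(Z)\le R$, and $\|h_{L,Z}\|\le m$, with $R,m$ independent of $L$. Let $E_1\le E_2\le\dots$ be the eigenvalues of $H_L$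 counted with multiplicities, and assume that there are $\gamma>0$, $\Delta>0$ and an integer $p\ge 1$, independent of $L$, with $\gamma>2\Delta$, such that $H_L$ has more than $p$ eigenvalues and $$E_{p+1}-E_p\ge\gamma,\qquad E_p-E_1\le\Delta .$$ Let $P_L$ be the spectral projector of $H_L$ for $\{E_1,\dots,E_p\}$. A sequence of operators $A=(A_L)$ is *almost supported* in a sequence of sets $Z_L\subset\Lambda_L$ if there are operators $A_{L,r}$, $r\in\mathbb N$, supported in $(Z_L)_{(r)}$, such that for every $k\in\mathbb N$ there is a constant $C_k$ with $\|A_L-A_{L,r}\|\le C_k\,\|A_L\|\,|Z_L|\,r^{-k}$ for all $L$ and all $r\ge 1$. **Proposition (finite-volume clustering).** Let $X_L,Y_L\subset\Lambda_L$ be disjoint for every $L$, let $A=(A_L)$ be almost supported in $(X_L)$ and $B=(B_L)$ almost supported in $(Y_L)$. Then for every $k\in\mathbb N$ there is a constant $C_k$ such that for all $L$ and all $\Omega\in\mathrm{ran}\,P_L$ with $\|\Omega\|=1$, $$\bigl|\langle\Omega,A_LB_L\Omega\rangle-\langle\Omega,A_LP_LB_L\Omega\rangle\bigr|\le C_k\,\|A_L\|\,\|B_L\|\,|X_L|\,|Y_L|\,d(X_L,Y_L)^{-k},$$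 where $d(X,Y)=\min_{x\in X,\,y\in Y}\mathrm{dist}(x,y)$ (the right-hand side is read as $0$ if $X_L$ or $Y_L$ is empty). -/

import Mathlib

noncomputable section

namespace ManyBody

/-- The two kinds of lattice systems: spins with `n` components per site, or fermions with `f`
flavours per site. -/
inductive SystemKind : Type
  | spin (n : ℕ)
  | fermion (f : ℕ)

/-- Labels of the canonical basis of the one-site space: `n` spin components, or the set of
occupied flavours (so `2 ^ f` labels). -/
abbrev SystemKind.State : SystemKind → Type
  | .spin n => Fin n
  | .fermion f => Finset (Fin f)

instance SystemKind.instFintypeState : (K : SystemKind) → Fintype K.State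
  | .spin n => inferInstanceAs (Fintype (Fin n))
  | .fermion f => inferInstanceAs (Fintype (Finset (Fin f)))

instance SystemKind.instDecidableEqState : (K : SystemKind) → DecidableEq K.State
  | .spin n => inferInstanceAs (DecidableEq (Fin n))
  | .fermion f => inferInstanceAs (DecidableEq (Finset (Fin f)))

/-- The Hilbert space of a system whose one-site basis is labelled by `κ`: functions of the
configurations `Λ → κ`, that is `(ℂ^κ)^{⊗ Λ}` in its product basis, or the fermionic Fock space in
its occupation number basis. Its dimension is `|κ| ^ |Λ|`. -/
abbrev StateSpace (κ Λ : Type*) [Fintype κ] [Fintype Λ] [DecidableEq Λ] :=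
  EuclideanSpace ℂ (Λ → κ)

/-- Operators on the Hilbert space, with the operator norm. -/
abbrev Operators (κ Λ : Type*) [Fintype κ] [Fintype Λ] [DecidableEq Λ] :=
  StateSpace κ Λ →L[ℂ] StateSpace κ Λ

section Locality

variable {Λ : Type*} [Fintype Λ]

/-- Spin systems: `O = O_S ⊗ 1` for some operator `O_S` on `(ℂ^κ)^{⊗ S}`, expressed through matrix
elements between product basis vectors. -/
def SpinSupported {κ : Type*} [Fintype κ] [DecidableEq κ] [DecidableEq Λ]
    (S : Finset Λ) (O : Operators κ Λ) : Prop :=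
  ∃ o : (S → κ) → (S → κ) → ℂ, ∀ σ τ : Λ → κ,
    O (EuclideanSpace.single τ 1) σ =
      if ∀ x, x ∉ S → σ x = τ x then o (fun x => σ x) (fun x => τ x) else 0

/-- The number of fermions in modes preceding `(x, α)` in the lexicographic order of modes. -/
def occupiedBefore [LinearOrder Λ] {f : ℕ} (σ : Λ → Finset (Fin f)) (x : Λ) (α : Fin f) : ℕ :=
  (∑ y ∈ Finset.univ.filter (fun y => y < x), (σ y).card) +
    ((σ x).filter (fun β => β < α)).card

/-- The annihilation operator `c_{x,α}` on the fermionic Fock space, in the occupation number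
basis. The linear order of the sites only serves to fix the signs of the basis vectors. -/
def annihilate [LinearOrder Λ] {f : ℕ} (x : Λ) (α : Fin f) : Operators (Finset (Fin f)) Λ :=
  LinearMap.toContinuousLinearMap
    { toFun := fun ψ => WithLp.toLp 2 fun σ =>
        if α ∈ σ x then 0
        else (-1 : ℂ) ^ occupiedBefore σ x α * ψ (Function.update σ x (insert α (σ x)))
      map_add' := by
        intro ψ φ
        ext σ
        by_cases hα : α ∈ σ x <;> simp [hα, mul_add]
      map_smul' := by
        intro a ψ
        ext σ
        by_cases hα : α ∈ σ x <;> simp [hα, mul_left_comm] }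

/-- The creation operator `c*_{x,α}`. -/
def create [LinearOrder Λ] {f : ℕ} (x : Λ) (α : Fin f) : Operators (Finset (Fin f)) Λ :=
  ContinuousLinearMap.adjoint (annihilate x α)

/-- Fermionic systems: `O` is in the linear span of the monomials of even degree in the creation
and annihilation operators of sites in `S`. -/
def FermionSupported [LinearOrder Λ] {f : ℕ}
    (S : Finset Λ) (O : Operators (Finset (Fin f)) Λ) : Prop :=
  O ∈ Submodule.span ℂ {M : Operators (Finset (Fin f)) Λ |
    ∃ l : List (Operators (Finset (Fin f)) Λ), Even l.length ∧
      (∀ a ∈ l, ∃ x ∈ S, ∃ α : Fin f, a = annihilate x α ∨ a = create x α) ∧ M = l.prod}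

/-- `O` is an observable whose support is contained in `S`. -/
def SupportedIn [LinearOrder Λ] :
    (K : SystemKind) → Finset Λ → Operators K.State Λ → Prop
  | .spin _, S, O => SpinSupported S O
  | .fermion _, S, O => FermionSupported S O

end Locality

section Geometry

variable {Λ : Type*} [Fintype Λ]

open Classical in
/-- The `r`-fattening of `S`: all vertices at graph distance at most `r` from `S`. -/
def fattening (G : SimpleGraph Λ) (S : Finset Λ) (r : ℕ) : Finset Λ :=
  Finset.univ.filter fun x => ∃ z ∈ S, G.dist x z ≤ r

/-- The distance between two sets of vertices (with value `0` if one of them is empty). -/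
def setDist (G : SimpleGraph Λ) (X Y : Finset Λ) : ℕ :=
  sInf {k | ∃ x ∈ X, ∃ y ∈ Y, k = G.dist x y}

/-- Balls of radius `r` have at most `C (1 + r) ^ d` vertices. -/
def BallGrowth (G : SimpleGraph Λ) (C : ℝ) (d : ℕ) : Prop :=
  ∀ (x : Λ) (r : ℕ), ((fattening G {x} r).card : ℝ) ≤ C * (1 + (r : ℝ)) ^ d

end Geometry

section Hamiltonian

variable {Λ : Type*} [Fintype Λ] [LinearOrder Λ]

/-- Local terms `h_Z` supported in `Z`, of range at most `R` and of norm at most `m`. -/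
structure IsFiniteRange (K : SystemKind) (G : SimpleGraph Λ) (R : ℕ) (m : ℝ)
    (h : Finset Λ → Operators K.State Λ) : Prop where
  supported : ∀ Z, SupportedIn K Z (h Z)
  range : ∀ Z, (∃ x ∈ Z, ∃ y ∈ Z, R < G.dist x y) → h Z = 0
  bound : ∀ Z, ‖h Z‖ ≤ m

/-- The Hamiltonian `∑_Z h_Z`. -/
def hamiltonian {K : SystemKind} (h : Finset Λ → Operators K.State Λ) : Operators K.State Λ :=
  ∑ Z, h Z

end Hamiltonian

section Spectrum

variable {E : Type*} [NormedAddCommGroup E] [InnerProductSpace ℂ E] [FiniteDimensional ℂ E]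

/-- The eigenvalues of the self-adjoint operator `H` in nondecreasing order, counted with
multiplicities; `energy hH j` is `E_{j+1}`. (The eigenvalues in Mathlib are nonincreasing.) -/
def energy {H : E →L[ℂ] E} (hH : IsSelfAdjoint H) (j : Fin (Module.finrank ℂ E)) : ℝ :=
  hH.isSymmetric.eigenvalues rfl j.rev

/-- The `p` lowest eigenvalues are separated by at least `γ` from the others, and have spread at
most `Δ`. -/
structure HasGap {H : E →L[ℂ] E} (hH : IsSelfAdjoint H) (p : ℕ) (γ Δ : ℝ) : Prop where
  pos : 1 ≤ p
  lt : p < Module.finrank ℂ E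
  gap : γ ≤ energy hH ⟨p, lt⟩ - energy hH ⟨p - 1, by omega⟩
  width : energy hH ⟨p - 1, by omega⟩ - energy hH ⟨0, by omega⟩ ≤ Δ

/-- The sum of the eigenspaces of `H` for the eigenvalues `E_1, …, E_p`. -/
def groundSpace {H : E →L[ℂ] E} (hH : IsSelfAdjoint H) (p : ℕ) : Submodule ℂ E :=
  ⨆ j : Fin (Module.finrank ℂ E), ⨆ _ : (j : ℕ) < p,
    Module.End.eigenspace (H : E →ₗ[ℂ] E) (energy hH j : ℂ)

/-- The spectral projector `P` for the eigenvalues `E_1, …, E_p`. -/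
def groundProjection {H : E →L[ℂ] E} (hH : IsSelfAdjoint H) (p : ℕ) : E →L[ℂ] E :=
  (groundSpace hH p).starProjection

end Spectrum

/-- The sequence of operators `A` is almost supported in the sequence of sets `Z`: there are
operators `A_{L,r}` supported in the `r`-fattenings of `Z_L` such that
`‖A_L - A_{L,r}‖ ≤ C_k ‖A_L‖ |Z_L| r^{-k}` with constants `C_k` that do not depend on `L`. -/
def AlmostSupported (K : SystemKind) {Λ : ℕ → Type*} [∀ L, Fintype (Λ L)]
    [∀ L, LinearOrder (Λ L)] (G : ∀ L, SimpleGraph (Λ L)) (Z : ∀ L, Finset (Λ L))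
    (A : ∀ L, Operators K.State (Λ L)) : Prop :=
  ∃ A' : ∀ L, ℕ → Operators K.State (Λ L),
    (∀ L r, SupportedIn K (fattening (G L) (Z L) r) (A' L r)) ∧
    ∀ k : ℕ, ∃ C : ℝ, ∀ L, ∀ r : ℕ, 1 ≤ r →
      ‖A L - A' L r‖ ≤ C * ‖A L‖ * ((Z L).card : ℝ) / (r : ℝ) ^ k

end ManyBody

end

/-! The proof combines finite speed of propagation with a spectral filter. Write B(t) = e^{-itH} B
e^{itH} and expand ⟨Ω, [A, B(t)] Ω⟩ in an eigenbasis of H. Each term of A B(t) or B(t) A oscillates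
at an energy difference E_j - E_k. Since Ω lies in the low-energy space, frequencies ≤ -γ come only
from the terms of A B(t) whose intermediate state is above the gap; all others are ≥ -Δ. As Δ < γ, a
smooth step falling inside (-γ, -Δ) isolates exactly ⟨Ω, A(1 - P)BΩ⟩.

In the time variable this filter is a Schwartz function divided by t. The quantity is therefore at
most a constant times D as soon as ‖[A, B(t)]‖ ≤ D |t| (1 + |t|)^N; the factor |t| cancels the
singularity, and a polynomial loss in t is harmless (`exists_spectral_filter_bound`,
`exists_clustering_bound_of_commutator_bound`). Such a bound, with D of order n^{-N} for supports n
steps apart, follows from the bound (J|t|)^n / n! of `lieb_robinson` and the trivial bound on a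
commutator (`exists_min_one_pow_div_factorial_le`). The locality input is that disjointly supported
observables commute, which for fermions rests on even degree.

For almost supported observables, A and B are replaced by approximants on fattenings of radius about
a third of the distance. The size of the fattening and the norms of the approximants cost powers of
|X| and of the radius. These are absorbed by a larger N, because the claim is trivial once |X|
exceeds the k-th power of the distance. -/

namespace ManyBody

/-! ### Locality for spin systems -/

section Supports

variable {κ Λ : Type*} [Fintype κ] [DecidableEq κ] [Fintype Λ] [DecidableEq Λ]

theorem operator_ext {O O' : Operators κ Λ}
    (h : ∀ τ, O (EuclideanSpace.single τ 1) = O' (EuclideanSpace.single τ 1)) : O = O' := by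
  apply ContinuousLinearMap.coe_injective
  refine (EuclideanSpace.basisFun (Λ → κ) ℂ).toBasis.ext fun τ => ?_
  simpa using h τ

theorem operator_apply_eq_sum (O : Operators κ Λ) (ψ : StateSpace κ Λ) (σ : Λ → κ) :
    O ψ σ = ∑ ρ, ψ ρ * O (EuclideanSpace.single ρ 1) σ := by
  conv_lhs => rw [← (EuclideanSpace.basisFun (Λ → κ) ℂ).sum_repr ψ]
  simp [map_sum, map_smul]

theorem adjoint_single_apply (O : Operators κ Λ) (σ τ : Λ → κ) :
    (ContinuousLinearMap.adjoint O) (EuclideanSpace.single τ 1) σ =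
      star (O (EuclideanSpace.single σ 1) τ) := by
  have h := ContinuousLinearMap.adjoint_inner_right O (EuclideanSpace.single σ (1 : ℂ))
    (EuclideanSpace.single τ (1 : ℂ))
  simpa [EuclideanSpace.inner_single_left, EuclideanSpace.inner_single_right] using h

/-- `O'` changes a configuration only on `T` and `O` only on `S`, so a single intermediate
configuration contributes: `σ` on `T` and `τ` elsewhere. The result is symmetric in the two factors,
which is why they commute. -/
theorem SpinSupported.mul_apply {S T : Finset Λ} (hST : Disjoint S T) {O O' : Operators κ Λ}
    {o : (S → κ) → (S → κ) → ℂ} {o' : (T → κ) → (T → κ) → ℂ}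
    (ho : ∀ σ τ : Λ → κ, O (EuclideanSpace.single τ 1) σ =
      if ∀ x, x ∉ S → σ x = τ x then o (fun x => σ x) (fun x => τ x) else 0)
    (ho' : ∀ σ τ : Λ → κ, O' (EuclideanSpace.single τ 1) σ =
      if ∀ x, x ∉ T → σ x = τ x then o' (fun x => σ x) (fun x => τ x) else 0)
    (σ τ : Λ → κ) :
    (O * O') (EuclideanSpace.single τ 1) σ =
      if ∀ x, x ∉ S → x ∉ T → σ x = τ x then
        o (fun x => σ x) (fun x => τ x) * o' (fun x => σ x) (fun x => τ x) else 0 := by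
  rw [mul_apply_eq_comp, operator_apply_eq_sum]
  set ρ : Λ → κ := fun x => if x ∈ T then σ x else τ x with hρ
  have hS : ∀ x ∈ S, x ∉ T := fun x hx hx' => Finset.disjoint_left.1 hST hx hx'
  rw [Finset.sum_eq_single ρ]
  · rw [ho, ho', if_pos (fun x hx => by simp [hρ, hx])]
    have e1 : (fun x : T => ρ x) = fun x : T => σ x := by
      funext x; simp [hρ, x.2]
    have e2 : (fun x : S => ρ x) = fun x : S => τ x := by
      funext x; simp [hρ, hS x x.2]
    rw [e1, e2]
    have hiff : (∀ x, x ∉ S → σ x = ρ x) ↔ ∀ x, x ∉ S → x ∉ T → σ x = τ x := by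
      refine forall₂_congr fun x _ => ?_
      by_cases hxT : x ∈ T <;> simp [hρ, hxT]
    by_cases hc : ∀ x, x ∉ S → x ∉ T → σ x = τ x
    · rw [if_pos hc, if_pos (hiff.2 hc), mul_comm]
    · rw [if_neg hc, if_neg (mt hiff.1 hc), mul_zero]
  · intro ρ' _ hne
    rw [ho, ho']
    by_contra hcon
    obtain ⟨h1, h2⟩ := mul_ne_zero_iff.1 hcon
    have h1' := of_not_not fun hn => h1 (if_neg hn)
    have h2' := of_not_not fun hn => h2 (if_neg hn)
    refine hne (funext fun x => ?_)
    by_cases hxT : x ∈ T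
    · simpa [hρ, hxT] using (h2' x fun hxS => hS x hxS hxT).symm
    · simpa [hρ, hxT] using h1' x hxT
  · simp

theorem SpinSupported.commute {S T : Finset Λ} (hST : Disjoint S T) {O O' : Operators κ Λ}
    (hO : SpinSupported S O) (hO' : SpinSupported T O') : Commute O O' := by
  obtain ⟨o, ho⟩ := hO
  obtain ⟨o', ho'⟩ := hO'
  refine operator_ext fun τ => ?_
  ext σ
  rw [SpinSupported.mul_apply hST ho ho', SpinSupported.mul_apply hST.symm ho' ho]
  have hiff : (∀ x, x ∉ S → x ∉ T → σ x = τ x) ↔ ∀ x, x ∉ T → x ∉ S → σ x = τ x :=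
    forall_congr' fun x => ⟨fun h a b => h b a, fun h a b => h b a⟩
  by_cases hc : ∀ x, x ∉ S → x ∉ T → σ x = τ x
  · rw [if_pos hc, if_pos (hiff.1 hc), mul_comm]
  · rw [if_neg hc, if_neg (mt hiff.2 hc)]

theorem SpinSupported.adjoint {S : Finset Λ} {O : Operators κ Λ} (hO : SpinSupported S O) :
    SpinSupported S (ContinuousLinearMap.adjoint O) := by
  obtain ⟨o, ho⟩ := hO
  refine ⟨fun σ τ => star (o τ σ), fun σ τ => ?_⟩
  rw [adjoint_single_apply, ho]
  by_cases hc : ∀ x, x ∉ S → σ x = τ x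
  · rw [if_pos hc, if_pos fun x hx => (hc x hx).symm]
  · rw [if_neg hc, if_neg fun hc' => hc fun x hx => (hc' x hx).symm, star_zero]

theorem SpinSupported.add {S : Finset Λ} {O O' : Operators κ Λ} (hO : SpinSupported S O)
    (hO' : SpinSupported S O') : SpinSupported S (O + O') := by
  obtain ⟨o, ho⟩ := hO
  obtain ⟨o', ho'⟩ := hO'
  refine ⟨fun σ τ => o σ τ + o' σ τ, fun σ τ => ?_⟩
  rw [_root_.add_apply, PiLp.add_apply, ho, ho']
  split_ifs <;> simp

theorem SpinSupported.smul {S : Finset Λ} {O : Operators κ Λ} (hO : SpinSupported S O) (z : ℂ) :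
    SpinSupported S (z • O) := by
  obtain ⟨o, ho⟩ := hO
  refine ⟨fun σ τ => z * o σ τ, fun σ τ => ?_⟩
  rw [_root_.smul_apply, PiLp.smul_apply, ho]
  split_ifs <;> simp

theorem SpinSupported.eq_smul_one {O : Operators κ Λ} (hO : SpinSupported ∅ O) :
    ∃ z : ℂ, O = z • 1 := by
  obtain ⟨o, ho⟩ := hO
  refine ⟨o (fun x => absurd x.2 (Finset.notMem_empty _))
    (fun x => absurd x.2 (Finset.notMem_empty _)), operator_ext fun τ => ?_⟩
  ext σ
  rw [ho]
  by_cases hc : σ = τ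
  · subst hc
    simp only [implies_true, if_true]
    rw [_root_.smul_apply, PiLp.smul_apply]
    simp only [one_apply_eq_self, PiLp.single_apply, if_true, smul_eq_mul, mul_one]
    congr 1 <;> exact funext fun x => absurd x.2 (Finset.notMem_empty _)
  · rw [if_neg fun h => hc (funext fun x => h x (Finset.notMem_empty x))]
    simp [hc]

end Supports

/-! ### Locality for fermions -/

section Fermions

variable {Λ : Type*} [Fintype Λ] [LinearOrder Λ] {f : ℕ}

/-- `O` acts on the occupation number basis through the occupation of `x` alone, changing the
number of fermions at `x` by an odd number, up to the sign of the mode `(x, α)`. -/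
def IsOddAt (x : Λ) (α : Fin f) (O : Operators (Finset (Fin f)) Λ) : Prop :=
  ∃ (q : Finset (Fin f) → Prop) (_ : DecidablePred q) (g : Finset (Fin f) → Finset (Fin f)),
    (∀ s, q s → Odd ((g s).card + s.card)) ∧
    ∀ τ : Λ → Finset (Fin f), O (EuclideanSpace.single τ 1) =
      if q (τ x) then (-1 : ℂ) ^ occupiedBefore τ x α •
        EuclideanSpace.single (Function.update τ x (g (τ x))) 1 else 0

theorem annihilate_apply (x : Λ) (α : Fin f) (ψ : StateSpace (Finset (Fin f)) Λ)
    (σ : Λ → Finset (Fin f)) :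
    annihilate x α ψ σ = if α ∈ σ x then 0
      else (-1 : ℂ) ^ occupiedBefore σ x α * ψ (Function.update σ x (insert α (σ x))) := rfl

/-- The sign counts strictly preceding modes only, so it can be read off before or after the mode
itself is filled. -/
theorem occupiedBefore_update_insert (τ : Λ → Finset (Fin f)) (x : Λ) (α : Fin f) :
    occupiedBefore (Function.update τ x (insert α (τ x))) x α = occupiedBefore τ x α := by
  unfold occupiedBefore
  congr 1
  · refine Finset.sum_congr rfl fun y hy => ?_
    rw [Function.update_of_ne (Finset.mem_filter.1 hy).2.ne]
  · simp [Finset.filter_insert]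

theorem annihilate_single (x : Λ) (α : Fin f) (τ : Λ → Finset (Fin f)) :
    annihilate x α (EuclideanSpace.single τ 1) =
      if α ∈ τ x then (-1 : ℂ) ^ occupiedBefore τ x α •
        EuclideanSpace.single (Function.update τ x ((τ x).erase α)) 1 else 0 := by
  ext σ
  rw [annihilate_apply]
  by_cases hτ : α ∈ τ x
  · rw [if_pos hτ, PiLp.smul_apply, PiLp.single_apply, PiLp.single_apply]
    by_cases hσ : σ = Function.update τ x ((τ x).erase α)
    · have hσx : σ x = (τ x).erase α := by rw [hσ, Function.update_self]
      have hup : Function.update σ x (insert α (σ x)) = τ := by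
        rw [hσx, Finset.insert_erase hτ, hσ]
        simp
      have hocc := occupiedBefore_update_insert σ x α
      rw [hup] at hocc
      rw [if_neg (by rw [hσx]; simp), if_pos hup, if_pos hσ, hocc]
      simp
    · rw [if_neg hσ]
      split_ifs with h1 h2
      · simp
      · refine absurd ?_ hσ
        rw [← h2]
        simp [Finset.erase_insert h1]
      · simp
  · rw [if_neg hτ]
    split_ifs with h1
    · rfl
    · rw [PiLp.single_apply, if_neg]
      · simp
      · intro h2
        apply hτ
        rw [← h2]
        simp

theorem create_single (x : Λ) (α : Fin f) (τ : Λ → Finset (Fin f)) :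
    create x α (EuclideanSpace.single τ 1) =
      if ¬ α ∈ τ x then (-1 : ℂ) ^ occupiedBefore τ x α •
        EuclideanSpace.single (Function.update τ x (insert α (τ x))) 1 else 0 := by
  ext σ
  rw [create, adjoint_single_apply, annihilate_apply]
  by_cases hτ : α ∈ τ x
  · rw [if_pos hτ, if_neg (not_not.2 hτ)]
    simp
  · rw [if_neg hτ, if_pos hτ, PiLp.smul_apply, PiLp.single_apply, PiLp.single_apply]
    by_cases hσ : σ = Function.update τ x (insert α (τ x))
    · rw [if_pos hσ, if_pos hσ.symm]
      simp
    · rw [if_neg hσ, if_neg (Ne.symm hσ)]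
      simp

theorem isOddAt_annihilate (x : Λ) (α : Fin f) : IsOddAt x α (annihilate x α) := by
  refine ⟨fun s => α ∈ s, inferInstance, fun s => s.erase α, fun s hs => ?_, annihilate_single x α⟩
  have := Finset.card_erase_add_one hs
  exact ⟨(s.erase α).card, by simp only; omega⟩

theorem isOddAt_create (x : Λ) (α : Fin f) : IsOddAt x α (create x α) := by
  refine ⟨fun s => ¬ α ∈ s, inferInstance, fun s => insert α s, fun s hs => ?_,
    create_single x α⟩
  rw [Finset.card_insert_of_notMem hs]
  exact ⟨s.card, by omega⟩

/-- A parity change at `x` is seen by the sign of a mode at `y` exactly when `x` precedes `y`. Of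
two distinct sites exactly one precedes the other, so exchanging two odd operators produces exactly
one minus sign. -/
theorem neg_one_pow_occupiedBefore_update {x y : Λ} (hxy : x ≠ y) (β : Fin f)
    (τ : Λ → Finset (Fin f)) {s : Finset (Fin f)} (hs : Odd (s.card + (τ x).card)) :
    (-1 : ℂ) ^ occupiedBefore (Function.update τ x s) y β =
      (if x < y then -1 else 1) * (-1) ^ occupiedBefore τ y β := by
  unfold occupiedBefore
  rw [Function.update_of_ne hxy.symm]
  split_ifs with hlt
  · have hmem : x ∈ Finset.univ.filter (fun z => z < y) := by simp [hlt]
    rw [← Finset.add_sum_erase _ _ hmem, ← Finset.add_sum_erase _ (fun z => (τ z).card) hmem,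
      Function.update_self]
    have hrest : ∑ z ∈ (Finset.univ.filter (fun z => z < y)).erase x,
        (Function.update τ x s z).card =
        ∑ z ∈ (Finset.univ.filter (fun z => z < y)).erase x, (τ z).card :=
      Finset.sum_congr rfl fun z hz => by
        rw [Function.update_of_ne (Finset.ne_of_mem_erase hz)]
    have hsign : (-1 : ℂ) ^ s.card = -(-1) ^ (τ x).card := by
      have h1 := hs.neg_one_pow (α := ℂ)
      rw [pow_add] at h1
      have h2 : ((-1 : ℂ) ^ (τ x).card) * (-1) ^ (τ x).card = 1 := by
        rw [← mul_pow]; simp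
      linear_combination (-1 : ℂ) ^ (τ x).card * h1 - (-1) ^ s.card * h2
    rw [hrest]
    simp only [pow_add, hsign]
    ring
  · rw [one_mul]
    congr 2
    refine Finset.sum_congr rfl fun z hz => ?_
    rw [Function.update_of_ne]
    rintro rfl
    exact hlt (Finset.mem_filter.1 hz).2

theorem IsOddAt.anticommute {x y : Λ} (hxy : x ≠ y) {α β : Fin f}
    {a b : Operators (Finset (Fin f)) Λ} (ha : IsOddAt x α a) (hb : IsOddAt y β b) :
    a * b = -(b * a) := by
  obtain ⟨q, _, g, hg, ha⟩ := ha
  obtain ⟨q', _, g', hg', hb⟩ := hb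
  refine operator_ext fun τ => ?_
  rw [_root_.neg_apply, mul_apply_eq_comp, mul_apply_eq_comp,
    ha, hb]
  by_cases h1 : q (τ x) <;> by_cases h2 : q' (τ y)
  · rw [if_pos h1, if_pos h2, map_smul, map_smul, ha, hb, Function.update_of_ne hxy,
      Function.update_of_ne hxy.symm, if_pos h1, if_pos h2,
      neg_one_pow_occupiedBefore_update hxy β τ (hg _ h1),
      neg_one_pow_occupiedBefore_update hxy.symm α τ (hg' _ h2),
      Function.update_comm hxy, smul_smul, smul_smul, ← neg_smul]
    congr 1
    rcases lt_or_gt_of_ne hxy with h | h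
    · rw [if_neg h.le.not_gt, if_pos h]; ring
    · rw [if_pos h, if_neg h.le.not_gt]; ring
  · rw [if_pos h1, if_neg h2, map_smul, hb, Function.update_of_ne hxy.symm, if_neg h2]
    simp
  · rw [if_neg h1, if_pos h2, map_smul, ha, Function.update_of_ne hxy, if_neg h1]
    simp
  · rw [if_neg h1, if_neg h2]
    simp

theorem mul_list_prod_of_anticommute {A : Type*} [Ring A] (a : A) (l : List A)
    (h : ∀ b ∈ l, a * b = -(b * a)) : a * l.prod = (-1) ^ l.length * (l.prod * a) := by
  induction l with
  | nil => simp
  | cons b l ih =>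
    rw [List.prod_cons, ← mul_assoc, h b (by simp), neg_mul, mul_assoc,
      ih fun b' hb' => h b' (List.mem_cons_of_mem _ hb'), List.length_cons, pow_succ]
    have hcomm : b * (-1) ^ l.length = (-1) ^ l.length * b :=
      ((Commute.neg_one_right b).pow_right _).eq
    rw [← mul_assoc b, hcomm]
    noncomm_ring

theorem commute_list_prod_of_anticommute {A : Type*} [Ring A] (a : A) (l : List A)
    (hl : Even l.length) (h : ∀ b ∈ l, a * b = -(b * a)) : Commute a l.prod := by
  have := mul_list_prod_of_anticommute a l h
  rwa [hl.neg_one_pow, one_mul] at this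

/-- By bilinearity it is enough to treat monomials. A single generator at a site of `S` anticommutes
with each of the evenly many generators in `T`, and the signs cancel. -/
theorem FermionSupported.commute {S T : Finset Λ} (hST : Disjoint S T)
    {O O' : Operators (Finset (Fin f)) Λ}
    (hO : FermionSupported S O) (hO' : FermionSupported T O') : Commute O O' := by
  have hgen : ∀ (U : Finset Λ) (a : Operators (Finset (Fin f)) Λ),
      (∃ x ∈ U, ∃ α : Fin f, a = annihilate x α ∨ a = create x α) →
      ∃ x ∈ U, ∃ α : Fin f, IsOddAt x α a := by
    rintro U a ⟨x, hx, α, rfl | rfl⟩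
    · exact ⟨x, hx, α, isOddAt_annihilate x α⟩
    · exact ⟨x, hx, α, isOddAt_create x α⟩
  refine Submodule.span_induction ?_ (Commute.zero_left _) (fun _ _ _ _ => Commute.add_left)
    (fun z _ _ h => h.smul_left z) hO
  rintro _ ⟨l, -, hl, rfl⟩
  refine Submodule.span_induction ?_ (Commute.zero_right _) (fun _ _ _ _ => Commute.add_right)
    (fun z _ _ h => h.smul_right z) hO'
  rintro _ ⟨l', hl', hl'', rfl⟩
  refine Commute.list_prod_left _ _ fun a ha => ?_
  obtain ⟨x, hx, α, hxa⟩ := hgen S a (hl a ha)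
  refine commute_list_prod_of_anticommute a l' hl' fun b hb => ?_
  · obtain ⟨y, hy, β, hyb⟩ := hgen T b (hl'' b hb)
    exact hxa.anticommute (by rintro rfl; exact Finset.disjoint_left.1 hST hx hy) hyb

theorem FermionSupported.adjoint {S : Finset Λ} {O : Operators (Finset (Fin f)) Λ}
    (hO : FermionSupported S O) : FermionSupported S (ContinuousLinearMap.adjoint O) := by
  refine Submodule.span_induction (p := fun O _ => FermionSupported S
    (ContinuousLinearMap.adjoint O)) ?_ ?_ ?_ ?_ hO
  · rintro _ ⟨l, hl, hl', rfl⟩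
    refine Submodule.subset_span ⟨(l.map star).reverse, by simpa using hl, fun a ha => ?_, ?_⟩
    · simp only [List.mem_reverse, List.mem_map] at ha
      obtain ⟨b, hb, rfl⟩ := ha
      obtain ⟨x, hx, α, rfl | rfl⟩ := hl' b hb
      · exact ⟨x, hx, α, Or.inr rfl⟩
      · exact ⟨x, hx, α, Or.inl (by simp [create, ContinuousLinearMap.star_eq_adjoint])⟩
    · rw [← ContinuousLinearMap.star_eq_adjoint]
      clear hl hl'
      induction l with
      | nil => simp
      | cons a l ih => simp [ih]
  · rw [map_zero]
    exact Submodule.zero_mem _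
  · intro a b _ _ ha hb
    rw [map_add]
    exact Submodule.add_mem _ ha hb
  · intro z a _ ha
    rw [LinearIsometryEquiv.map_smulₛₗ]
    exact Submodule.smul_mem _ _ ha

theorem FermionSupported.eq_smul_one {O : Operators (Finset (Fin f)) Λ}
    (hO : FermionSupported ∅ O) : ∃ z : ℂ, O = z • 1 := by
  have h : O ∈ Submodule.span ℂ {(1 : Operators (Finset (Fin f)) Λ)} := by
    refine Submodule.span_mono ?_ hO
    rintro _ ⟨l, -, hl, rfl⟩
    cases l with
    | nil => simp
    | cons a l =>
      obtain ⟨x, hx, -⟩ := hl a (by simp)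
      exact absurd hx (Finset.notMem_empty x)
  obtain ⟨z, hz⟩ := Submodule.mem_span_singleton.1 h
  exact ⟨z, hz.symm⟩

end Fermions

/-! ### Locality for both kinds of systems -/

section SupportedIn

variable {K : SystemKind} {Λ : Type*} [Fintype Λ] [LinearOrder Λ]

theorem SupportedIn.commute {S T : Finset Λ} (hST : Disjoint S T) {O O' : Operators K.State Λ}
    (hO : SupportedIn K S O) (hO' : SupportedIn K T O') : Commute O O' := by
  cases K with
  | spin n => exact SpinSupported.commute hST hO hO'
  | fermion f => exact FermionSupported.commute hST hO hO'

theorem SupportedIn.adjoint {S : Finset Λ} {O : Operators K.State Λ}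
    (hO : SupportedIn K S O) : SupportedIn K S (ContinuousLinearMap.adjoint O) := by
  cases K with
  | spin n => exact SpinSupported.adjoint hO
  | fermion f => exact FermionSupported.adjoint hO

theorem SupportedIn.add {S : Finset Λ} {O O' : Operators K.State Λ}
    (hO : SupportedIn K S O) (hO' : SupportedIn K S O') : SupportedIn K S (O + O') := by
  cases K with
  | spin n => exact SpinSupported.add hO hO'
  | fermion f => exact Submodule.add_mem _ hO hO'

theorem SupportedIn.smul {S : Finset Λ} {O : Operators K.State Λ}
    (hO : SupportedIn K S O) (z : ℂ) : SupportedIn K S (z • O) := by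
  cases K with
  | spin n => exact SpinSupported.smul hO z
  | fermion f => exact Submodule.smul_mem _ z hO

theorem SupportedIn.eq_smul_one {O : Operators K.State Λ}
    (hO : SupportedIn K ∅ O) : ∃ z : ℂ, O = z • 1 := by
  cases K with
  | spin n => exact SpinSupported.eq_smul_one hO
  | fermion f => exact FermionSupported.eq_smul_one hO

end SupportedIn

end ManyBody

/-! ### Growth of commutators in a C⋆-algebra -/

section LiebRobinson

open NormedSpace

variable {𝔸 : Type*} [CStarAlgebra 𝔸]

/-- The conjugation of `b` by the one-parameter group generated by `x`. -/
noncomputable def evolve (x b : 𝔸) (t : ℝ) : 𝔸 := exp (t • -x) * b * exp (t • x)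

theorem exp_smul_mem_unitary {x : 𝔸} (hx : x ∈ skewAdjoint 𝔸) (t : ℝ) :
    exp (t • x) ∈ unitary 𝔸 := by
  let _ : NormedAlgebra ℚ 𝔸 := NormedAlgebra.restrictScalars ℚ ℝ 𝔸
  exact exp_mem_unitary_of_mem_skewAdjoint (skewAdjoint.smul_mem t hx)

@[simp]
theorem evolve_zero (x b : 𝔸) : evolve x b 0 = b := by
  simp [evolve]

theorem evolve_neg (x b : 𝔸) (t : ℝ) : evolve (-x) b t = evolve x b (-t) := by
  simp [evolve]

theorem norm_evolve {x : 𝔸} (hx : x ∈ skewAdjoint 𝔸) (b : 𝔸) (t : ℝ) :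
    ‖evolve x b t‖ = ‖b‖ := by
  rw [evolve, CStarRing.norm_mul_mem_unitary _ (exp_smul_mem_unitary hx t),
    CStarRing.norm_mem_unitary_mul _ (exp_smul_mem_unitary (neg_mem hx) t)]

theorem hasDerivAt_evolve (x b : 𝔸) (t : ℝ) :
    HasDerivAt (evolve x b) (evolve x b t * x - x * evolve x b t) t := by
  have h1 := hasDerivAt_exp_smul_const' (𝕂 := ℝ) (-x) t
  have h2 := hasDerivAt_exp_smul_const (𝕂 := ℝ) x t
  have h := (h1.mul_const b).mul h2
  refine h.congr_deriv ?_
  simp only [evolve]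
  noncomm_ring

theorem norm_commutator_le (a b : 𝔸) : ‖a * b - b * a‖ ≤ 2 * ‖a‖ * ‖b‖ := by
  calc ‖a * b - b * a‖ ≤ ‖a‖ * ‖b‖ + ‖b‖ * ‖a‖ :=
        (norm_sub_le _ _).trans (add_le_add (norm_mul_le _ _) (norm_mul_le _ _))
    _ = 2 * ‖a‖ * ‖b‖ := by ring

/-- Interaction picture: the part `y` of the generator commutes with `a`, so it acts on the
commutator of `a` with the evolved `b` by a unitary conjugation. Undoing that conjugation preserves
norms and leaves only `x - y` in the derivative. -/
theorem norm_commutator_evolve_le {x y a b : 𝔸} (hy : y ∈ skewAdjoint 𝔸) (hya : Commute y a)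
    (hab : Commute a b) {F F' : ℝ → ℝ} (hF0 : 0 ≤ F 0) (hF : ∀ s, HasDerivAt F (F' s) s)
    (hbound : ∀ s, 0 ≤ s →
      2 * ‖a‖ * ‖(x - y) * evolve x b s - evolve x b s * (x - y)‖ ≤ F' s)
    {t : ℝ} (ht : 0 ≤ t) : ‖a * evolve x b t - evolve x b t * a‖ ≤ F t := by
  set c : ℝ → 𝔸 := fun s => a * evolve x b s - evolve x b s * a with hc
  set e : ℝ → 𝔸 := fun s => (x - y) * evolve x b s - evolve x b s * (x - y) with he
  have hnorm : ∀ s, ‖evolve (-y) (c s) s‖ = ‖c s‖ := fun s => norm_evolve (neg_mem hy) _ _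
  have hnorm' : ∀ s, ‖evolve (-y) (e s * a - a * e s) s‖ = ‖e s * a - a * e s‖ :=
    fun s => norm_evolve (neg_mem hy) _ _
  have hderiv : ∀ s, HasDerivAt (fun s => evolve (-y) (c s) s)
      (evolve (-y) (e s * a - a * e s) s) s := by
    intro s
    have h1 := hasDerivAt_exp_smul_const (𝕂 := ℝ) (- -y) s
    have h2 := hasDerivAt_exp_smul_const' (𝕂 := ℝ) (-y) s
    have hb := hasDerivAt_evolve x b s
    have hca : HasDerivAt c _ s := (hb.const_mul a).sub (hb.mul_const a)
    refine ((h1.mul hca).mul h2).congr_deriv ?_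
    -- The Jacobi identity, with [y, a] = 0.
    have key : y * (a * evolve x b s - evolve x b s * a) +
        (a * (evolve x b s * x - x * evolve x b s) - (evolve x b s * x - x * evolve x b s) * a)
        - (a * evolve x b s - evolve x b s * a) * y = e s * a - a * e s := by
      have h3 : y * a = a * y := hya
      have h4 : ∀ z, y * (a * z) = a * (y * z) := fun z => by
        rw [← mul_assoc, h3, mul_assoc]
      simp only [he, mul_sub, sub_mul, mul_assoc, h3, h4]
      abel
    rw [← key, ← show c s = a * evolve x b s - evolve x b s * a from rfl]
    simp only [evolve, neg_neg, Pi.mul_apply]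
    noncomm_ring
  have hmain := image_norm_le_of_norm_deriv_right_le_deriv_boundary
    (f := fun s => evolve (-y) (c s) s) (a := 0) (b := t)
    (fun s _ => (hderiv s).continuousAt.continuousWithinAt)
    (fun s _ => (hderiv s).hasDerivWithinAt) (B := F) (B' := F')
    (by simpa [hc, hab.eq] using hF0) hF
    (fun s hs => by
      rw [hnorm']
      refine (norm_commutator_le _ _).trans ((le_of_eq ?_).trans (hbound s hs.1))
      simp only [he]
      ring)
    (Set.right_mem_Icc.2 ht)
  rwa [hnorm] at hmain

end LiebRobinson

namespace ManyBody

/-! ### The Lieb–Robinson bound on the lattice -/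

section LatticeLiebRobinson

theorem mem_fattening {Λ : Type*} [Fintype Λ] {G : SimpleGraph Λ} {S : Finset Λ} {r : ℕ} {x : Λ} :
    x ∈ fattening G S r ↔ ∃ z ∈ S, G.dist x z ≤ r := by
  simp [fattening]

variable {K : SystemKind} {Λ : Type*} [Fintype Λ] [LinearOrder Λ]

theorem I_smul_mem_skewAdjoint {𝔸 : Type*} [CStarAlgebra 𝔸] {a : 𝔸} (ha : IsSelfAdjoint a) :
    Complex.I • a ∈ skewAdjoint 𝔸 := by
  rw [skewAdjoint.mem_iff, star_smul, ha.star_eq]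
  simp

section CStar

variable {𝔸 : Type*} [CStarAlgebra 𝔸]

theorem isSelfAdjoint_finset_sum {ι : Type*} (s : Finset ι) {a : ι → 𝔸}
    (ha : ∀ i, IsSelfAdjoint (a i)) : IsSelfAdjoint (∑ i ∈ s, a i) :=
  isSelfAdjoint_sum _ fun i _ => ha i

theorem isSelfAdjoint_neg_of {a : 𝔸} (ha : IsSelfAdjoint a) : IsSelfAdjoint (-a) :=
  ha.neg

theorem isSelfAdjoint_half_add_star (a : 𝔸) : IsSelfAdjoint ((2⁻¹ : ℂ) • (a + star a)) := by
  rw [isSelfAdjoint_iff, star_smul, star_add, star_star, add_comm (star a)]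
  simp

theorem sum_half_add_star {ι : Type*} (s : Finset ι) {a : ι → 𝔸}
    (ha : IsSelfAdjoint (∑ i ∈ s, a i)) :
    ∑ i ∈ s, (2⁻¹ : ℂ) • (a i + star (a i)) = ∑ i ∈ s, a i := by
  rw [← Finset.smul_sum, Finset.sum_add_distrib, ← star_sum, ha.star_eq, ← two_smul ℂ, smul_smul]
  norm_num

theorem norm_half_add_star_le (a : 𝔸) : ‖(2⁻¹ : ℂ) • (a + star a)‖ ≤ ‖a‖ := by
  have h1 := norm_add_le a (star a)
  rw [norm_star] at h1
  rw [norm_smul]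
  norm_num
  linarith

theorem half_add_star_eq_zero {a : 𝔸} (ha : a = 0) : (2⁻¹ : ℂ) • (a + star a) = 0 := by
  simp [ha]

theorem norm_I_smul_commutator (a b : 𝔸) :
    ‖Complex.I • a * b - b * Complex.I • a‖ = ‖a * b - b * a‖ := by
  rw [smul_mul_assoc, mul_smul_comm, ← smul_sub, norm_smul, Complex.norm_I, one_mul]

theorem I_smul_sum_neg {ι : Type*} (s : Finset ι) (a : ι → 𝔸) :
    Complex.I • ∑ i ∈ s, -a i = -(Complex.I • ∑ i ∈ s, a i) := by
  simp

end CStar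

open Classical in
/-- The regions whose interaction terms may fail to commute with observables in `X`. -/
noncomputable def touching (h : Finset Λ → Operators K.State Λ) (X : Finset Λ) :
    Finset (Finset Λ) :=
  Finset.univ.filter fun Z => h Z ≠ 0 ∧ ¬ Disjoint Z X

theorem mem_touching {h : Finset Λ → Operators K.State Λ} {X Z : Finset Λ} :
    Z ∈ touching h X ↔ h Z ≠ 0 ∧ ¬ Disjoint Z X := by
  simp [touching]

theorem IsFiniteRange.dist_le {G : SimpleGraph Λ} {R : ℕ} {m : ℝ}
    {h : Finset Λ → Operators K.State Λ} (hh : IsFiniteRange K G R m h) {Z : Finset Λ}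
    (hZ : h Z ≠ 0) {x y : Λ} (hx : x ∈ Z) (hy : y ∈ Z) : G.dist x y ≤ R := by
  by_contra hcon
  exact hZ (hh.range Z ⟨x, hx, y, hy, not_le.1 hcon⟩)

theorem IsFiniteRange.subset_fattening {G : SimpleGraph Λ} {R : ℕ} {m : ℝ}
    {h : Finset Λ → Operators K.State Λ} (hh : IsFiniteRange K G R m h) {Z : Finset Λ}
    (hZ : h Z ≠ 0) {x : Λ} (hx : x ∈ Z) : Z ⊆ fattening G {x} R :=
  fun _ hy => mem_fattening.2 ⟨x, by simp, hh.dist_le hZ hy hx⟩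

/-- Each such region is a subset of a ball of radius `R` centred in `X`, and a ball has at most `2 ^
M` subsets. -/
theorem IsFiniteRange.card_touching_le {G : SimpleGraph Λ} {R : ℕ} {m : ℝ}
    {h : Finset Λ → Operators K.State Λ} (hh : IsFiniteRange K G R m h) {M : ℕ}
    (hM : ∀ x, (fattening G {x} R).card ≤ M) (X : Finset Λ) :
    (touching h X).card ≤ X.card * 2 ^ M := by
  have hsub : touching h X ⊆ X.biUnion fun x => (fattening G {x} R).powerset := by
    intro Z hZ
    obtain ⟨hZ0, hZX⟩ := mem_touching.1 hZ
    obtain ⟨x, hxZ, hxX⟩ := Finset.not_disjoint_iff.1 hZX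
    exact Finset.mem_biUnion.2 ⟨x, hxX, Finset.mem_powerset.2 (hh.subset_fattening hZ0 hxZ)⟩
  refine (Finset.card_le_card hsub).trans (Finset.card_biUnion_le_card_mul _ _ _ fun x _ => ?_)
  rw [Finset.card_powerset]
  exact Nat.pow_le_pow_right two_pos (hM x)

theorem IsFiniteRange.nonneg {G : SimpleGraph Λ} {R : ℕ} {m : ℝ}
    {h : Finset Λ → Operators K.State Λ} (hh : IsFiniteRange K G R m h) : 0 ≤ m :=
  (norm_nonneg _).trans (hh.bound ∅)

/-- Only terms touching `X` drive the growth of the commutator, and each is an observable still `n`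
steps from `Y`, to which induction applies. Every step integrates once in time, hence the factorial;
the number of regions, their size and the norm of a term give the rate `2 ^ (M + 1) * m * M`. -/
theorem norm_commutator_evolve_le_of_selfAdjoint {G : SimpleGraph Λ} (hG : G.Connected) {R : ℕ}
    {m : ℝ} {h : Finset Λ → Operators K.State Λ} (hh : IsFiniteRange K G R m h)
    (hsa : ∀ Z, IsSelfAdjoint (h Z)) {M : ℕ} (hM : ∀ x, (fattening G {x} R).card ≤ M)
    {Y : Finset Λ} {B : Operators K.State Λ} (hB : SupportedIn K Y B) (n : ℕ) :
    ∀ {X : Finset Λ} {A : Operators K.State Λ}, X.Nonempty → SupportedIn K X A →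
      (∀ x ∈ X, ∀ y ∈ Y, n * (R + 1) ≤ G.dist x y) → ∀ {t : ℝ}, 0 ≤ t →
      ‖A * evolve (Complex.I • hamiltonian h) B t -
          evolve (Complex.I • hamiltonian h) B t * A‖ ≤
        2 * ‖A‖ * ‖B‖ * X.card * (2 ^ (M + 1) * m * M * t) ^ n / n.factorial := by
  have hm := hh.nonneg
  have hHsa : IsSelfAdjoint (hamiltonian h) := isSelfAdjoint_finset_sum _ hsa
  have hskew := I_smul_mem_skewAdjoint hHsa
  set J : ℝ := 2 ^ (M + 1) * m * M with hJ
  induction n with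
  | zero =>
    intro X A hX hA _ t ht
    refine (norm_commutator_le _ _).trans ?_
    rw [norm_evolve hskew]
    have : (1 : ℝ) ≤ X.card := by exact_mod_cast hX.card_pos
    simpa using le_mul_of_one_le_right (by positivity) this
  | succ n ih =>
    intro X A hX hA hsep t ht
    have hdisj : Disjoint X Y := by
      refine Finset.disjoint_left.2 fun x hx hy => ?_
      have := hsep x hx x hy
      rw [SimpleGraph.dist_self] at this
      exact absurd this (Nat.not_le.2 (by positivity))
    set y : Operators K.State Λ := Complex.I • ∑ Z ∈ (touching h X)ᶜ, h Z with hy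
    have hysa : y ∈ skewAdjoint (Operators K.State Λ) :=
      I_smul_mem_skewAdjoint (isSelfAdjoint_finset_sum _ hsa)
    have hyA : Commute y A := by
      refine Commute.smul_left (Commute.sum_left _ _ _ fun Z hZ => ?_) _
      rw [Finset.mem_compl, mem_touching, not_and_or, not_not, not_not] at hZ
      rcases hZ with hZ | hZ
      · rw [hZ]
        exact Commute.zero_left _
      · exact (hh.supported Z).commute hZ hA
    have hxy : Complex.I • hamiltonian h - y = ∑ Z ∈ touching h X, Complex.I • h Z := by
      rw [hy, hamiltonian, ← Finset.sum_add_sum_compl (touching h X), smul_add, add_sub_cancel_right,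
        Finset.smul_sum]
    have hfac : ((n + 1).factorial : ℝ) = (n + 1) * n.factorial := by
      rw [Nat.factorial_succ]; push_cast; ring
    have hfac0 : (n.factorial : ℝ) ≠ 0 := by positivity
    refine norm_commutator_evolve_le hysa hyA (hA.commute hdisj hB)
      (F := fun s => 2 * ‖A‖ * ‖B‖ * X.card * (J * s) ^ (n + 1) / (n + 1).factorial)
      (F' := fun s => 2 * ‖A‖ * ‖B‖ * X.card * J * (J * s) ^ n / n.factorial) (by simp) ?_ ?_ ht
    · intro s
      have h1 := (((((hasDerivAt_id s).const_mul J).pow (n + 1)).const_mul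
        (2 * ‖A‖ * ‖B‖ * X.card)).div_const ((n + 1).factorial : ℝ))
      refine h1.congr_deriv ?_
      rw [hfac]
      simp only [id, add_tsub_cancel_right, Nat.cast_add, Nat.cast_one]
      field_simp
    · intro s hs
      rw [hxy, Finset.sum_mul, Finset.mul_sum, ← Finset.sum_sub_distrib]
      have hterm : ∀ Z ∈ touching h X,
          ‖Complex.I • h Z * evolve (Complex.I • hamiltonian h) B s -
            evolve (Complex.I • hamiltonian h) B s * Complex.I • h Z‖ ≤
          2 * m * ‖B‖ * M * (J * s) ^ n / n.factorial := by
        intro Z hZ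
        obtain ⟨hZ0, hZX⟩ := mem_touching.1 hZ
        obtain ⟨x, hxZ, hxX⟩ := Finset.not_disjoint_iff.1 hZX
        refine (norm_I_smul_commutator _ _).le.trans ?_
        have hcard : (Z.card : ℝ) ≤ M := by
          exact_mod_cast (Finset.card_le_card (hh.subset_fattening hZ0 hxZ)).trans (hM x)
        refine (ih ⟨x, hxZ⟩ (hh.supported Z) (fun z hz y hy => ?_) hs).trans ?_
        · have h1 := hsep x hxX y hy
          have h2 := hG.dist_triangle (u := x) (v := z) (w := y)
          have h3 := hh.dist_le hZ0 hxZ hz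
          rw [add_mul] at h1
          omega
        · have hJ0 : 0 ≤ J := by positivity
          have := hh.bound Z
          gcongr
      have hcard : ((touching h X).card : ℝ) ≤ X.card * 2 ^ M := by
        exact_mod_cast hh.card_touching_le hM X
      have hJ0 : 0 ≤ J := by positivity
      calc 2 * ‖A‖ * ‖∑ Z ∈ touching h X,
            (Complex.I • h Z * evolve (Complex.I • hamiltonian h) B s -
              evolve (Complex.I • hamiltonian h) B s * Complex.I • h Z)‖
          ≤ 2 * ‖A‖ * ((X.card * 2 ^ M) * (2 * m * ‖B‖ * M * (J * s) ^ n / n.factorial)) := by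
            gcongr
            refine (norm_sum_le_of_le _ hterm).trans ?_
            rw [Finset.sum_const, nsmul_eq_mul]
            gcongr
        _ = 2 * ‖A‖ * ‖B‖ * X.card * J * (J * s) ^ n / n.factorial := by
            rw [hJ, pow_succ]
            ring

/-- The interaction consisting of the real parts of the terms of `h`. -/
noncomputable def realPartTerms (h : Finset Λ → Operators K.State Λ) (Z : Finset Λ) :
    Operators K.State Λ :=
  (2⁻¹ : ℂ) • (h Z + star (h Z))

theorem isSelfAdjoint_realPartTerms (h : Finset Λ → Operators K.State Λ) (Z : Finset Λ) :
    IsSelfAdjoint (realPartTerms h Z) :=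
  isSelfAdjoint_half_add_star (h Z)

/-- Only the sum of the terms is assumed self-adjoint, whereas the interaction picture needs
self-adjoint partial sums. Taking real parts changes neither the Hamiltonian nor the locality
bounds. -/
theorem hamiltonian_realPartTerms {h : Finset Λ → Operators K.State Λ}
    (hH : IsSelfAdjoint (hamiltonian h)) : hamiltonian (realPartTerms h) = hamiltonian h :=
  sum_half_add_star _ hH

theorem IsFiniteRange.realPartTerms {G : SimpleGraph Λ} {R : ℕ} {m : ℝ}
    {h : Finset Λ → Operators K.State Λ} (hh : IsFiniteRange K G R m h) :
    IsFiniteRange K G R m (realPartTerms h) where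
  supported Z := ((hh.supported Z).add (hh.supported Z).adjoint).smul _
  range Z hZ := half_add_star_eq_zero (hh.range Z hZ)
  bound Z := (norm_half_add_star_le (h Z)).trans (hh.bound Z)

theorem IsFiniteRange.neg {G : SimpleGraph Λ} {R : ℕ} {m : ℝ}
    {h : Finset Λ → Operators K.State Λ} (hh : IsFiniteRange K G R m h) :
    IsFiniteRange K G R m (-h) where
  supported Z := by
    have h1 := (hh.supported Z).smul (-1)
    have h2 : (-1 : ℂ) • h Z = -h Z := neg_one_smul ℂ (h Z)
    rwa [h2] at h1
  range Z hZ := by simp [hh.range Z hZ]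
  bound Z := by simpa using hh.bound Z

/-- The Lieb–Robinson bound. -/
theorem lieb_robinson {G : SimpleGraph Λ} (hG : G.Connected) {R : ℕ}
    {m : ℝ} {h : Finset Λ → Operators K.State Λ} (hh : IsFiniteRange K G R m h)
    (hH : IsSelfAdjoint (hamiltonian h)) {M : ℕ} (hM : ∀ x, (fattening G {x} R).card ≤ M)
    {X Y : Finset Λ} {A B : Operators K.State Λ} (hX : X.Nonempty) (hA : SupportedIn K X A)
    (hB : SupportedIn K Y B) {n : ℕ} (hsep : ∀ x ∈ X, ∀ y ∈ Y, n * (R + 1) ≤ G.dist x y) (t : ℝ) :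
    ‖A * evolve (Complex.I • hamiltonian h) B t - evolve (Complex.I • hamiltonian h) B t * A‖ ≤
      2 * ‖A‖ * ‖B‖ * X.card * (2 ^ (M + 1) * m * M * |t|) ^ n / n.factorial := by
  have key := fun s hs => norm_commutator_evolve_le_of_selfAdjoint hG hh.realPartTerms
    (isSelfAdjoint_realPartTerms h) hM hB n hX hA hsep (t := s) hs
  -- Negative times are positive times for the opposite Hamiltonian.
  have key' := fun s hs => norm_commutator_evolve_le_of_selfAdjoint hG hh.realPartTerms.neg
    (fun Z => isSelfAdjoint_neg_of (isSelfAdjoint_realPartTerms h Z)) hM hB n hX hA hsep (t := s) hs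
  have hneg : Complex.I • hamiltonian (-realPartTerms h) = -(Complex.I • hamiltonian h) := by
    rw [← hamiltonian_realPartTerms hH]
    exact I_smul_sum_neg _ _
  rw [hamiltonian_realPartTerms hH] at key
  simp only [hneg, evolve_neg] at key'
  rcases le_total 0 t with ht | ht
  · rw [abs_of_nonneg ht]
    exact key t ht
  · have := key' (-t) (neg_nonneg.2 ht)
    rw [neg_neg] at this
    rwa [abs_of_nonpos ht]

end LatticeLiebRobinson

/-- Factorial decay beats every power, with a linear factor to spare at the origin. -/
theorem exists_min_one_pow_div_factorial_le (N : ℕ) : ∃ C : ℝ, 0 ≤ C ∧ ∀ (y : ℝ) (n : ℕ), 0 ≤ y →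
    1 ≤ n → min 1 (y ^ n / n.factorial) ≤ C * y * (1 + y) ^ N / (n : ℝ) ^ N := by
  obtain ⟨C₁, hC₁⟩ : ∃ C₁ : ℝ, ∀ n : ℕ, (n : ℝ) ^ N * (1 / 2) ^ n ≤ C₁ := by
    have ht := tendsto_pow_const_mul_const_pow_of_lt_one N (r := (1 / 2 : ℝ)) (by norm_num)
      (by norm_num)
    obtain ⟨C, hC⟩ := ht.bddAbove_range
    exact ⟨C, fun n => hC ⟨n, rfl⟩⟩
  set e := Real.exp 1 with he
  have he1 : 1 ≤ e := Real.one_le_exp zero_le_one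
  refine ⟨max ((2 * e) ^ (N + 1)) (2 * e * C₁), le_max_of_le_left (by positivity),
    fun y n hy hn => ?_⟩
  have hn0 : (0 : ℝ) < n := by exact_mod_cast hn
  have hn1 : (1 : ℝ) ≤ n := by exact_mod_cast hn
  have hy1 : (1 : ℝ) ≤ (1 + y) ^ N := one_le_pow₀ (by linarith)
  rw [le_div_iff₀ (by positivity)]
  -- Outside the light cone n ≤ 2ey, n! ≥ (n/e)^n makes the term at most 2^{-n}; inside it, powers
  -- of n are powers of y.
  rcases le_total (n : ℝ) (2 * e * y) with hcase | hcase
  · calc min 1 (y ^ n / n.factorial) * (n : ℝ) ^ N ≤ 1 * (n : ℝ) ^ (N + 1) := by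
          gcongr
          · exact min_le_left _ _
          · exact N.le_succ
      _ ≤ (2 * e * y) ^ (N + 1) := by rw [one_mul]; gcongr
      _ = (2 * e) ^ (N + 1) * y * y ^ N := by rw [mul_pow, pow_succ y]; ring
      _ ≤ _ := by
          gcongr
          · exact le_max_left _ _
          · linarith
  · have hfac : (n : ℝ) ^ n / n.factorial ≤ e ^ n := by
      refine (Real.pow_div_factorial_le_exp n hn0.le n).trans (le_of_eq ?_)
      rw [he, ← Real.exp_nat_mul, mul_one]
    have hz : e * y / n ≤ 1 / 2 := by
      rw [div_le_div_iff₀ hn0 two_pos]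
      linarith
    have h1 : y ^ n / n.factorial ≤ (e * y / n) ^ n := by
      calc y ^ n / n.factorial = (y / n) ^ n * ((n : ℝ) ^ n / n.factorial) := by
            rw [div_pow]; field_simp
        _ ≤ (y / n) ^ n * e ^ n := by gcongr
        _ = (e * y / n) ^ n := by rw [← mul_pow]; congr 1; ring
    -- One of the `n` factors is kept as the linear factor in `y`.
    have h2 : (e * y / n) ^ n ≤ 2 * e * y * (1 / 2) ^ n := by
      obtain ⟨k, rfl⟩ : ∃ k, n = k + 1 := ⟨n - 1, by omega⟩
      have h3 : e * y / ((k + 1 : ℕ) : ℝ) ≤ e * y := div_le_self (by positivity) hn1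
      calc (e * y / ((k + 1 : ℕ) : ℝ)) ^ (k + 1)
          = (e * y / ((k + 1 : ℕ) : ℝ)) ^ k * (e * y / ((k + 1 : ℕ) : ℝ)) := pow_succ _ _
        _ ≤ (1 / 2) ^ k * (e * y) := by gcongr
        _ = 2 * e * y * (1 / 2) ^ (k + 1) := by rw [pow_succ]; ring
    have hC₁0 : 0 ≤ C₁ := le_trans (by positivity) (hC₁ 0)
    calc min 1 (y ^ n / n.factorial) * (n : ℝ) ^ N ≤ 2 * e * y * (1 / 2) ^ n * (n : ℝ) ^ N := by
          gcongr
          exact (min_le_right _ _).trans (h1.trans h2)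
      _ = 2 * e * y * ((n : ℝ) ^ N * (1 / 2) ^ n) := by ring
      _ ≤ 2 * e * y * C₁ := by gcongr; exact hC₁ n
      _ = 2 * e * C₁ * y * 1 := by ring
      _ ≤ _ := by
          gcongr
          exact le_max_right _ _

end ManyBody

/-! ### A smooth step function as a frequency filter -/

section SpectralFilter

open MeasureTheory FourierTransform

theorem exists_schwartz_integral_eq_one {a b : ℝ} (hab : a < b) :
    ∃ g : SchwartzMap ℝ ℂ, (∀ u, u ≤ a ∨ b ≤ u → g u = 0) ∧ ∫ u, g u = 1 := by
  let f : ContDiffBump ((a + b) / 2) :=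
    { rIn := (b - a) / 4, rOut := (b - a) / 2, rIn_pos := by linarith, rIn_lt_rOut := by linarith }
  have hcs : HasCompactSupport fun u => ((f.normed volume u : ℝ) : ℂ) :=
    (f.hasCompactSupport_normed (μ := volume)).comp_left Complex.ofReal_zero
  have hcd : ContDiff ℝ (⊤ : ℕ∞) fun u => ((f.normed volume u : ℝ) : ℂ) :=
    Complex.ofRealCLM.contDiff.comp f.contDiff_normed
  refine ⟨hcs.toSchwartzMap hcd, fun u hu => ?_, ?_⟩
  · have hsupp : u ∉ Function.support (f.normed volume) := by
      rw [f.support_normed_eq, Metric.mem_ball, Real.dist_eq, not_lt]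
      change (b - a) / 2 ≤ _
      rcases hu with hu | hu
      · rw [le_abs]; right; linarith
      · rw [le_abs]; left; linarith
    simpa using hsupp
  · simp only [HasCompactSupport.toSchwartzMap_toFun]
    rw [integral_complex_ofReal, f.integral_normed, Complex.ofReal_one]

/-- Fourier inversion integrated over a bounded interval. Keeping the inner integral unevaluated
avoids the singularity at `s = 0` in Fubini. -/
theorem integral_fourier_mul_intervalIntegral (g : SchwartzMap ℝ ℂ) (b w : ℝ) :
    ∫ s, (𝓕 g) s * (∫ u in b..w, Complex.exp ((2 * Real.pi * s * u : ℝ) * Complex.I)) =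
      ∫ u in b..w, g u := by
  have hinv : ∀ u, ∫ s, (𝓕 g) s * Complex.exp ((2 * Real.pi * s * u : ℝ) * Complex.I) = g u := by
    intro u
    have h1 : 𝓕⁻ (𝓕 g) u = g u := by rw [FourierTransform.fourierInv_fourier_eq]
    rw [SchwartzMap.fourierInv_coe, Real.fourierInv_eq'] at h1
    rw [← h1]
    refine integral_congr_ae (.of_forall fun s => ?_)
    simp only [smul_eq_mul, mul_comm ((𝓕 g) s), RCLike.inner_apply, conj_trivial]
    congr 3
    push_cast
    ring
  simp_rw [← intervalIntegral.integral_const_mul]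
  rw [← intervalIntegral_integral_swap]
  · exact intervalIntegral.integral_congr fun u _ => hinv u
  · have : IsFiniteMeasure (volume.restrict (Set.uIoc b w)) :=
      ⟨by simp [Set.uIoc, Real.volume_Ioc]⟩
    have hb : Integrable (fun z : ℝ × ℝ => (1 : ℂ) * (𝓕 g) z.2)
        ((volume.restrict (Set.uIoc b w)).prod volume) :=
      Integrable.mul_prod (integrable_const _) (𝓕 g).integrable
    have h := hb.mul_bdd (c := 1)
      (g := fun z => Complex.exp ((2 * Real.pi * z.2 * z.1 : ℝ) * Complex.I))
      (Continuous.aestronglyMeasurable (by fun_prop))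
      (.of_forall fun z => by rw [Complex.norm_exp_ofReal_mul_I])
    simp only [one_mul] at h
    exact h

/-- The indicator of low frequencies agrees off the window `(a, b)` with minus the primitive of a
bump in that window. In time this is a Schwartz function over `t`, so `C` depends on the window and
`N` alone, not on the number of frequencies. -/
theorem exists_spectral_filter_bound {a b : ℝ} (hab : a < b) (N : ℕ) : ∃ C : ℝ, 0 ≤ C ∧
    ∀ {ι : Type} [Fintype ι] (c : ι → ℂ) (w : ι → ℝ), ∑ i, c i = 0 →
      (∀ i, c i ≠ 0 → w i ≤ a ∨ b ≤ w i) → ∀ D : ℝ,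
      (∀ t : ℝ, ‖∑ i, c i * Complex.exp ((t * w i : ℝ) * Complex.I)‖ ≤
        D * |t| * (1 + |t|) ^ N) →
      ‖∑ i, if w i ≤ a then c i else 0‖ ≤ C * D := by
  obtain ⟨g, hg0, hg1⟩ := exists_schwartz_integral_eq_one hab
  set F : SchwartzMap ℝ ℂ := 𝓕 g with hF
  set e : ℝ → ℝ → ℂ := fun s u => Complex.exp ((2 * Real.pi * s * u : ℝ) * Complex.I) with he
  have hint : Integrable fun s => ‖F s‖ * (1 + 2 * Real.pi * |s|) ^ N := by
    have h1 : Integrable fun s => 2 ^ (N - 1) *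
        (‖F s‖ + (2 * Real.pi) ^ N * (‖s‖ ^ N * ‖F s‖)) :=
      (F.integrable.norm.add ((F.integrable_pow_mul volume N).const_mul _)).const_mul _
    refine h1.mono' ?_ (.of_forall fun s => ?_)
    · have := F.continuous
      exact Continuous.aestronglyMeasurable (by fun_prop)
    · rw [Real.norm_of_nonneg (by positivity)]
      have h2 := add_pow_le (zero_le_one (α := ℝ)) (b := 2 * Real.pi * |s|) (by positivity) N
      calc ‖F s‖ * (1 + 2 * Real.pi * |s|) ^ N
          ≤ ‖F s‖ * (2 ^ (N - 1) * (1 ^ N + (2 * Real.pi * |s|) ^ N)) := by gcongr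
        _ = _ := by rw [one_pow, mul_pow, Real.norm_eq_abs]; ring
  refine ⟨∫ s, ‖F s‖ * (1 + 2 * Real.pi * |s|) ^ N, integral_nonneg fun s => by positivity,
    fun {ι} _ c w hc hw D hD => ?_⟩
  -- The primitive based at `b` vanishes above the window and equals -1 below it.
  have hval : ∀ i, c i * ∫ u in b..w i, g u = -(if w i ≤ a then c i else 0) := by
    intro i
    by_cases hci : c i = 0
    · simp [hci]
    rcases hw i hci with h | h
    · rw [if_pos h, intervalIntegral.integral_symm,
        intervalIntegral.integral_eq_integral_of_support_subset, hg1]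
      · ring
      · intro u hu
        by_contra hcon
        refine hu (hg0 u ?_)
        rw [Set.mem_Ioc, not_and_or] at hcon
        rcases hcon with hcon | hcon
        · left; linarith
        · right; linarith
    · rw [if_neg (by linarith), intervalIntegral.integral_congr (g := fun _ => (0 : ℂ))]
      · simp
      · intro u hu
        rw [Set.uIcc_of_le h] at hu
        exact hg0 u (Or.inr hu.1)
  have hcont : ∀ i, Continuous fun s => ∫ u in b..w i, e s u := fun i =>
    intervalIntegral.continuous_parametric_intervalIntegral_of_continuous' (by fun_prop) _ _
  have hIe : ∀ i s, ‖∫ u in b..w i, e s u‖ ≤ |w i - b| := by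
    intro i s
    have := intervalIntegral.norm_integral_le_of_norm_le_const (a := b) (b := w i) (C := 1)
      (f := e s) fun u _ => by rw [he, Complex.norm_exp_ofReal_mul_I]
    rwa [one_mul] at this
  have hInt : ∀ i, Integrable fun s => c i * (F s * ∫ u in b..w i, e s u) := fun i =>
    ((F.integrable.mul_bdd (hcont i).aestronglyMeasurable (.of_forall (hIe i)))).const_mul _
  have hsum : ∑ i, (if w i ≤ a then c i else 0) =
      -∫ s, ∑ i, c i * (F s * ∫ u in b..w i, e s u) := by
    rw [integral_finsetSum _ fun i _ => hInt i, ← Finset.sum_neg_distrib]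
    refine Finset.sum_congr rfl fun i _ => ?_
    rw [integral_const_mul, integral_fourier_mul_intervalIntegral, hval, neg_neg]
  rw [hsum, norm_neg, ← integral_mul_const]
  refine norm_integral_le_of_norm_le (hint.mul_const D) ?_
  have hne : ∀ᵐ s : ℝ, s ≠ 0 := by simp [ae_iff]
  filter_upwards [hne] with s hs
  have hpi := Real.pi_pos
  have hk : ((2 * Real.pi * s : ℝ) : ℂ) * Complex.I ≠ 0 := by
    refine mul_ne_zero ?_ Complex.I_ne_zero
    exact_mod_cast mul_ne_zero (by positivity) hs
  have hexp : ∀ i, ∫ u in b..w i, e s u =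
      (Complex.exp ((2 * Real.pi * s * w i : ℝ) * Complex.I) -
        Complex.exp ((2 * Real.pi * s * b : ℝ) * Complex.I)) /
          (((2 * Real.pi * s : ℝ) : ℂ) * Complex.I) := by
    intro i
    have h1 := integral_exp_mul_complex (a := b) (b := w i) hk
    have h2 : ∀ u : ℝ, ((2 * Real.pi * s : ℝ) : ℂ) * Complex.I * (u : ℂ) =
        (2 * Real.pi * s * u : ℝ) * Complex.I := by
      intro u; push_cast; ring
    simpa only [h2] using h1
  have hfac : ∑ i, c i * (F s * ∫ u in b..w i, e s u) =
      F s * ((∑ i, c i * Complex.exp ((2 * Real.pi * s * w i : ℝ) * Complex.I)) /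
        (((2 * Real.pi * s : ℝ) : ℂ) * Complex.I)) := by
    -- The contribution of the endpoint `b` drops out because the coefficients sum to zero.
    have h3 : ∑ i, c i * Complex.exp ((2 * Real.pi * s * b : ℝ) * Complex.I) = 0 := by
      rw [← Finset.sum_mul, hc, zero_mul]
    rw [← sub_zero (∑ i, c i * Complex.exp ((2 * Real.pi * s * w i : ℝ) * Complex.I)), ← h3,
      ← Finset.sum_sub_distrib, Finset.sum_div, Finset.mul_sum]
    refine Finset.sum_congr rfl fun i _ => ?_
    rw [hexp]
    ring
  rw [hfac, norm_mul, norm_div, norm_mul, Complex.norm_I, mul_one, Complex.norm_real,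
    Real.norm_eq_abs, mul_assoc ‖F s‖]
  have habs : |2 * Real.pi * s| = 2 * Real.pi * |s| := by
    rw [abs_mul, abs_of_pos (by positivity)]
  have hpos : 0 < |2 * Real.pi * s| := by rw [habs]; positivity
  -- The factor `|t|` of the hypothesis, at `t = 2πs`, cancels the denominator.
  refine mul_le_mul_of_nonneg_left ?_ (norm_nonneg _)
  rw [div_le_iff₀ hpos]
  refine (hD (2 * Real.pi * s)).trans (le_of_eq ?_)
  rw [habs]
  ring

end SpectralFilter

namespace ManyBody

/-! ### From commutator bounds to clustering, using the gap -/

section SpectralGap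

variable {E : Type*} [NormedAddCommGroup E] [InnerProductSpace ℂ E] [FiniteDimensional ℂ E]

theorem exp_apply_of_apply_eq_smul {T : E →L[ℂ] E} {v : E} {z : ℂ} (h : T v = z • v) :
    NormedSpace.exp T v = Complex.exp z • v := by
  have h1 := (NormedSpace.exp_series_hasSum_exp' (𝕂 := ℂ) T).mapL
    (ContinuousLinearMap.apply ℂ E v)
  have h2 := ((NormedSpace.exp_series_hasSum_exp' (𝕂 := ℂ) z).smul_const v)
  rw [← Complex.exp_eq_exp_ℂ] at h2
  refine h1.unique (h2.congr_fun fun n => ?_)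
  have hpow : ∀ n : ℕ, (T ^ n) v = z ^ n • v := by
    intro n
    induction n with
    | zero => simp
    | succ n ih => rw [pow_succ', mul_apply_eq_comp, ih, map_smul, h, smul_smul,
        pow_succ]
  simp [hpow, smul_smul]

variable {H : E →L[ℂ] E} (hH : IsSelfAdjoint H)

/-- An orthonormal eigenbasis of `H`, in nonincreasing order of the eigenvalues. -/
noncomputable abbrev eigenbasis : OrthonormalBasis (Fin (Module.finrank ℂ E)) ℂ E :=
  hH.isSymmetric.eigenvectorBasis rfl

theorem apply_eigenbasis (k : Fin (Module.finrank ℂ E)) :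
    H (eigenbasis hH k) = (energy hH k.rev : ℂ) • eigenbasis hH k := by
  have := hH.isSymmetric.apply_eigenvectorBasis rfl k
  rw [energy, Fin.rev_rev]
  exact this

theorem exp_apply_eigenbasis (t : ℝ) (k : Fin (Module.finrank ℂ E)) :
    NormedSpace.exp (t • Complex.I • H) (eigenbasis hH k) =
      Complex.exp ((t * energy hH k.rev : ℝ) * Complex.I) • eigenbasis hH k := by
  refine exp_apply_of_apply_eq_smul ?_
  rw [_root_.smul_apply, _root_.smul_apply, apply_eigenbasis,
    ← Complex.coe_smul, smul_smul, smul_smul]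
  congr 1
  push_cast
  ring

theorem inner_evolve (B : E →L[ℂ] E) (t : ℝ) (u v : E) :
    inner ℂ u (evolve (Complex.I • H) B t v) = ∑ k, ∑ j,
      inner ℂ u (eigenbasis hH k) * inner ℂ (eigenbasis hH k) (B (eigenbasis hH j)) *
        inner ℂ (eigenbasis hH j) v *
        Complex.exp ((t * (energy hH j.rev - energy hH k.rev) : ℝ) * Complex.I) := by
  have hexp : ∀ (s : ℝ) (w : E), NormedSpace.exp (s • Complex.I • H) w =
      ∑ j, inner ℂ (eigenbasis hH j) w •
        Complex.exp ((s * energy hH j.rev : ℝ) * Complex.I) • eigenbasis hH j := by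
    intro s w
    conv_lhs => rw [← (eigenbasis hH).sum_repr' w]
    rw [map_sum]
    refine Finset.sum_congr rfl fun j _ => ?_
    rw [map_smul, exp_apply_eigenbasis]
  rw [evolve, smul_neg, ← neg_smul, mul_apply_eq_comp, mul_apply_eq_comp,
    hexp (-t), inner_sum]
  refine Finset.sum_congr rfl fun k _ => ?_
  rw [hexp t, map_sum, inner_sum, inner_smul_right, inner_smul_right, Finset.sum_mul]
  refine Finset.sum_congr rfl fun j _ => ?_
  rw [map_smul, map_smul, inner_smul_right, inner_smul_right]
  have : Complex.exp ((t * (energy hH j.rev - energy hH k.rev) : ℝ) * Complex.I) =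
      Complex.exp ((-t * energy hH k.rev : ℝ) * Complex.I) *
        Complex.exp ((t * energy hH j.rev : ℝ) * Complex.I) := by
    rw [← Complex.exp_add]
    congr 1
    push_cast
    ring
  rw [this]
  ring

theorem energy_mono {i j : Fin (Module.finrank ℂ E)} (hij : i ≤ j) :
    energy hH i ≤ energy hH j :=
  hH.isSymmetric.eigenvalues_antitone rfl (Fin.rev_le_rev.2 hij)

variable {hH} {p : ℕ} {γ Δ : ℝ}

theorem HasGap.energy_le (h : HasGap hH p γ Δ) {i j : Fin (Module.finrank ℂ E)}
    (hi : (i : ℕ) < p) : energy hH i ≤ energy hH j + Δ := by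
  have h1 := h.width
  have hp := h.lt
  have h2 : energy hH i ≤ energy hH ⟨p - 1, by omega⟩ :=
    energy_mono hH (Fin.le_def.2 (by simp only; omega))
  have h3 : energy hH ⟨0, by omega⟩ ≤ energy hH j := energy_mono hH (Fin.le_def.2 (by simp))
  linarith

theorem HasGap.energy_add_le (h : HasGap hH p γ Δ) {i j : Fin (Module.finrank ℂ E)}
    (hi : (i : ℕ) < p) (hj : ¬ (j : ℕ) < p) : energy hH i + γ ≤ energy hH j := by
  have h1 := h.gap
  have hp := h.lt
  have h2 : energy hH i ≤ energy hH ⟨p - 1, by omega⟩ :=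
    energy_mono hH (Fin.le_def.2 (by simp only; omega))
  have h3 : energy hH ⟨p, by omega⟩ ≤ energy hH j :=
    energy_mono hH (Fin.le_def.2 (by simp only; omega))
  linarith

theorem groundProjection_eigenbasis_of_lt {k : Fin (Module.finrank ℂ E)} (hk : (k.rev : ℕ) < p) :
    groundProjection hH p (eigenbasis hH k) = eigenbasis hH k := by
  rw [groundProjection, Submodule.starProjection_eq_self_iff]
  exact le_iSup₂_of_le (f := fun (j : Fin (Module.finrank ℂ E)) (_ : (j : ℕ) < p) =>
    Module.End.eigenspace (H : E →ₗ[ℂ] E) (energy hH j : ℂ)) k.rev hk le_rfl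
    (Module.End.mem_eigenspace_iff.2 (apply_eigenbasis hH k))

theorem HasGap.groundProjection_eigenbasis_of_not_lt (h : HasGap hH p γ Δ) (hγ : 0 < γ)
    {k : Fin (Module.finrank ℂ E)} (hk : ¬ (k.rev : ℕ) < p) :
    groundProjection hH p (eigenbasis hH k) = 0 := by
  rw [groundProjection, Submodule.starProjection_apply_eq_zero_iff]
  have hle : groundSpace hH p ≤ (ℂ ∙ eigenbasis hH k)ᗮ := by
    refine iSup₂_le fun j hj v hv => ?_
    rw [Submodule.mem_orthogonal_singleton_iff_inner_right]
    have hv' : H v = (energy hH j : ℂ) • v := Module.End.mem_eigenspace_iff.1 hv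
    have h1 : inner ℂ (H (eigenbasis hH k)) v = inner ℂ (eigenbasis hH k) (H v) :=
      hH.isSymmetric _ _
    rw [hv', apply_eigenbasis, inner_smul_left, inner_smul_right, Complex.conj_ofReal] at h1
    have h2 := h.energy_add_le hj hk
    have h3 : (energy hH k.rev : ℂ) ≠ energy hH j := by
      exact_mod_cast (by linarith : energy hH j < energy hH k.rev).ne'
    by_contra hne
    exact h3 (mul_right_cancel₀ hne h1)
  rw [Submodule.mem_orthogonal]
  intro u hu
  exact Submodule.mem_orthogonal_singleton_iff_inner_left.1 (hle hu)

theorem inner_groundProjection_right (u v : E) :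
    inner ℂ u (groundProjection hH p v) = inner ℂ (groundProjection hH p u) v := by
  rw [groundProjection, Submodule.inner_starProjection_left_eq_right]

theorem groundProjection_apply_of_mem_range {v : E} (hv : v ∈ (groundProjection hH p).range) :
    groundProjection hH p v = v := by
  obtain ⟨w, rfl⟩ := hv
  rw [groundProjection]
  exact Submodule.starProjection_eq_self_iff.2 (Submodule.starProjection_apply_mem _ w)

theorem HasGap.inner_eq_zero (h : HasGap hH p γ Δ) (hγ : 0 < γ) {v : E}
    (hv : v ∈ (groundProjection hH p).range) {k : Fin (Module.finrank ℂ E)}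
    (hk : ¬ (k.rev : ℕ) < p) : inner ℂ (eigenbasis hH k) v = 0 := by
  rw [← groundProjection_apply_of_mem_range hv, inner_groundProjection_right,
    h.groundProjection_eigenbasis_of_not_lt hγ hk, inner_zero_left]

/-- If the commutator of `A` with the evolved `B` is small for short times and grows polynomially,
then `A` and `B` are uncorrelated in the low energy states. -/
theorem exists_clustering_bound_of_commutator_bound (hγ : 0 < γ) (hΔγ : Δ < γ) (N : ℕ) :
    ∃ C : ℝ, 0 ≤ C ∧ ∀ {E : Type*} [NormedAddCommGroup E] [InnerProductSpace ℂ E]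
      [FiniteDimensional ℂ E] {H : E →L[ℂ] E} {hH : IsSelfAdjoint H} {p : ℕ},
      HasGap hH p γ Δ → ∀ {A B : E →L[ℂ] E}, Commute A B → ∀ D : ℝ,
      (∀ t, ‖A * evolve (Complex.I • H) B t - evolve (Complex.I • H) B t * A‖ ≤
        D * |t| * (1 + |t|) ^ N) →
      ∀ v ∈ (groundProjection hH p).range, ‖v‖ = 1 →
        ‖inner ℂ v (A (B v)) - inner ℂ v (A (groundProjection hH p (B v)))‖ ≤ C * D := by
  obtain ⟨C, hC0, hC⟩ := exists_spectral_filter_bound (neg_lt_neg hΔγ) N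
  refine ⟨C, hC0, ?_⟩
  intro E _ _ _ H hH p hgap A B hAB D hD v hv hv1
  let ι := Fin (Module.finrank ℂ E) × Fin (Module.finrank ℂ E)
  -- The left summand collects the terms of A B(t), the right one those of -B(t) A.
  let c : ι ⊕ ι → ℂ := Sum.elim
    (fun q => inner ℂ (ContinuousLinearMap.adjoint A v) (eigenbasis hH q.1) * inner ℂ (eigenbasis hH q.1) (B (eigenbasis hH q.2)) *
      inner ℂ (eigenbasis hH q.2) v)
    (fun q => -(inner ℂ v (eigenbasis hH q.1) * inner ℂ (eigenbasis hH q.1) (B (eigenbasis hH q.2)) * inner ℂ (eigenbasis hH q.2) (A v)))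
  let ω : ι ⊕ ι → ℝ := Sum.elim
    (fun q => energy hH q.2.rev - energy hH q.1.rev)
    (fun q => energy hH q.2.rev - energy hH q.1.rev)
  have hexpand : ∀ t : ℝ, ∑ i, c i * Complex.exp ((t * ω i : ℝ) * Complex.I) =
      inner ℂ v ((A * evolve (Complex.I • H) B t - evolve (Complex.I • H) B t * A) v) := by
    intro t
    rw [_root_.sub_apply, mul_apply_eq_comp,
      mul_apply_eq_comp, inner_sub_right, ← ContinuousLinearMap.adjoint_inner_left,
      inner_evolve hH, inner_evolve hH, Fintype.sum_sum_type, Fintype.sum_prod_type,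
      Fintype.sum_prod_type]
    simp only [c, ω, Sum.elim_inl, Sum.elim_inr, neg_mul, Finset.sum_neg_distrib,
      sub_eq_add_neg]
  -- This is the commutator at time zero.
  have hsum : ∑ i, c i = 0 := by
    have h0 := hexpand 0
    simpa [hAB.eq] using h0
  -- In A B(t) the final index `j` is low, so the frequency depends on whether `k` is above the gap;
  -- in B(t) A the index `k` is low, so the frequency is at least -Δ.
  have hc : ∀ i, c i ≠ 0 → ω i ≤ -γ ∨ -Δ ≤ ω i := by
    rintro (⟨k, j⟩ | ⟨k, j⟩) hne
    · have hj : (j.rev : ℕ) < p := by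
        by_contra hj
        apply hne
        simp only [c, Sum.elim_inl]
        rw [hgap.inner_eq_zero hγ hv hj, mul_zero]
      by_cases hk : (k.rev : ℕ) < p
      · right
        have := hgap.energy_le (j := j.rev) hk
        simp only [ω, Sum.elim_inl]
        linarith
      · left
        have := hgap.energy_add_le hj hk
        simp only [ω, Sum.elim_inl]
        linarith
    · have hk : (k.rev : ℕ) < p := by
        by_contra hk
        apply hne
        simp only [c, Sum.elim_inr]
        rw [← inner_conj_symm, hgap.inner_eq_zero hγ hv hk]
        simp
      right
      have := hgap.energy_le (j := j.rev) hk
      simp only [ω, Sum.elim_inr]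
      linarith
  have hres : ∑ i, (if ω i ≤ -γ then c i else 0) =
      inner ℂ v (A (B v)) - inner ℂ v (A (groundProjection hH p (B v))) := by
    rw [← ContinuousLinearMap.adjoint_inner_left A (B v),
      ← ContinuousLinearMap.adjoint_inner_left A (groundProjection hH p (B v)),
      ← inner_sub_right, ← (eigenbasis hH).sum_inner_mul_inner, Fintype.sum_sum_type]
    have hr : ∑ q, (if ω (Sum.inr q) ≤ -γ then c (Sum.inr q) else 0) = 0 := by
      refine Finset.sum_eq_zero fun q _ => ?_
      rw [ite_eq_right_iff]
      intro hq
      by_contra hne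
      have hk : (q.1.rev : ℕ) < p := by
        by_contra hk
        apply hne
        simp only [c, Sum.elim_inr]
        rw [← inner_conj_symm, hgap.inner_eq_zero hγ hv hk]
        simp
      have := hgap.energy_le (j := q.2.rev) hk
      simp only [ω, Sum.elim_inr] at hq
      linarith
    rw [hr, add_zero, Fintype.sum_prod_type]
    refine Finset.sum_congr rfl fun k _ => ?_
    have hBv : inner ℂ (eigenbasis hH k) (B v) = ∑ j, inner ℂ (eigenbasis hH k) (B (eigenbasis hH j)) * inner ℂ (eigenbasis hH j) v := by
      conv_lhs => rw [← (eigenbasis hH).sum_repr' v, map_sum, inner_sum]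
      refine Finset.sum_congr rfl fun j _ => ?_
      rw [map_smul, inner_smul_right, mul_comm]
    rw [inner_sub_right, inner_groundProjection_right]
    by_cases hk : (k.rev : ℕ) < p
    · rw [groundProjection_eigenbasis_of_lt hk, sub_self, mul_zero]
      refine Finset.sum_eq_zero fun j _ => ?_
      rw [ite_eq_right_iff]
      intro hq
      have := hgap.energy_le (j := j.rev) hk
      simp only [ω, Sum.elim_inl] at hq
      linarith
    · rw [hgap.groundProjection_eigenbasis_of_not_lt hγ hk, inner_zero_left, sub_zero, hBv,
        Finset.mul_sum]
      refine Finset.sum_congr rfl fun j _ => ?_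
      by_cases hj : (j.rev : ℕ) < p
      · have := hgap.energy_add_le hj hk
        rw [if_pos (by simp only [ω, Sum.elim_inl]; linarith)]
        simp only [c, Sum.elim_inl]
        ring
      · rw [hgap.inner_eq_zero hγ hv hj]
        simp only [c, Sum.elim_inl]
        rw [hgap.inner_eq_zero hγ hv hj]
        simp
  rw [← hres]
  refine hC c ω hsum hc D fun t => ?_
  rw [hexpand]
  refine (norm_inner_le_norm _ _).trans ?_
  rw [hv1, one_mul]
  refine (ContinuousLinearMap.le_opNorm _ _).trans ?_
  rw [hv1, mul_one]
  exact hD t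

end SpectralGap

end ManyBody

namespace ManyBody

/-! ### Clustering for local observables and their approximation -/

section Clustering

theorem BallGrowth.card_fattening_le {Λ : Type*} [Fintype Λ] {G : SimpleGraph Λ} {c : ℝ} {d : ℕ}
    (hgrowth : BallGrowth G c d) (X : Finset Λ) (r : ℕ) :
    ((fattening G X r).card : ℝ) ≤ X.card * (c * (1 + r) ^ d) := by
  classical
  have hsub : fattening G X r ⊆ X.biUnion fun x => fattening G {x} r := by
    intro y hy
    obtain ⟨x, hx, hxy⟩ := mem_fattening.1 hy
    exact Finset.mem_biUnion.2 ⟨x, hx, mem_fattening.2 ⟨x, by simp, hxy⟩⟩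
  calc ((fattening G X r).card : ℝ) ≤ ((∑ x ∈ X, (fattening G {x} r).card : ℕ) : ℝ) := by
        exact_mod_cast (Finset.card_le_card hsub).trans Finset.card_biUnion_le
    _ ≤ ∑ _x ∈ X, c * (1 + (r : ℝ)) ^ d := by
        push_cast
        exact Finset.sum_le_sum fun x _ => hgrowth x r
    _ = X.card * (c * (1 + r) ^ d) := by rw [Finset.sum_const, nsmul_eq_mul]

theorem fattening_empty {Λ : Type*} [Fintype Λ] (G : SimpleGraph Λ) (r : ℕ) :
    fattening G ∅ r = ∅ := by
  simp [fattening]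

theorem subset_fattening {Λ : Type*} [Fintype Λ] (G : SimpleGraph Λ) (X : Finset Λ) (r : ℕ) :
    X ⊆ fattening G X r :=
  fun x hx => mem_fattening.2 ⟨x, hx, by simp⟩

theorem setDist_le {Λ : Type*} [Fintype Λ] (G : SimpleGraph Λ) {X Y : Finset Λ} {x y : Λ}
    (hx : x ∈ X) (hy : y ∈ Y) : setDist G X Y ≤ G.dist x y :=
  Nat.sInf_le ⟨x, hx, y, hy, rfl⟩

theorem setDist_le_dist_of_mem_fattening {Λ : Type*} [Fintype Λ] {G : SimpleGraph Λ}
    (hG : G.Connected) {X Y : Finset Λ} {r : ℕ} {x y : Λ} (hx : x ∈ fattening G X r)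
    (hy : y ∈ fattening G Y r) : setDist G X Y ≤ G.dist x y + 2 * r := by
  obtain ⟨x', hx', hxx'⟩ := mem_fattening.1 hx
  obtain ⟨y', hy', hyy'⟩ := mem_fattening.1 hy
  have h1 := setDist_le G hx' hy'
  have h2 := hG.dist_triangle (u := x') (v := x) (w := y')
  have h3 := hG.dist_triangle (u := x) (v := y) (w := y')
  rw [SimpleGraph.dist_comm] at hxx'
  omega

theorem setDist_pos {Λ : Type*} [Fintype Λ] {G : SimpleGraph Λ}
    (hG : G.Connected) {X Y : Finset Λ} (hX : X.Nonempty) (hY : Y.Nonempty)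
    (hXY : Disjoint X Y) : 0 < setDist G X Y := by
  obtain ⟨x, hx⟩ := hX
  obtain ⟨y, hy⟩ := hY
  obtain ⟨x', hx', y', hy', h⟩ := Nat.sInf_mem
    (s := {k | ∃ x ∈ X, ∃ y ∈ Y, k = G.dist x y}) ⟨_, x, hx, y, hy, rfl⟩
  rw [setDist, h]
  refine hG.pos_dist_of_ne ?_
  rintro rfl
  exact Finset.disjoint_left.1 hXY hx' hy'

/-- Clustering for strictly local observables. -/
theorem exists_local_clustering_bound (K : SystemKind) (c : ℝ) (d R : ℕ) (m : ℝ) {γ Δ : ℝ}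
    (hγ : 0 < γ) (hΔγ : Δ < γ) (N : ℕ) : ∃ C : ℝ, 0 ≤ C ∧
    ∀ {Λ : Type*} [Fintype Λ] [LinearOrder Λ] {G : SimpleGraph Λ}, G.Connected →
      BallGrowth G c d → ∀ {h : Finset Λ → Operators K.State Λ}, IsFiniteRange K G R m h →
      ∀ {hH : IsSelfAdjoint (hamiltonian h)} {p : ℕ}, HasGap hH p γ Δ →
      ∀ {X Y : Finset Λ} {A B : Operators K.State Λ}, X.Nonempty → SupportedIn K X A →
      SupportedIn K Y B → ∀ {n : ℕ}, 1 ≤ n → (∀ x ∈ X, ∀ y ∈ Y, n * (R + 1) ≤ G.dist x y) →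
      ∀ v ∈ (groundProjection hH p).range, ‖v‖ = 1 →
        ‖inner ℂ v (A (B v)) - inner ℂ v (A (groundProjection hH p (B v)))‖ ≤
          C * ‖A‖ * ‖B‖ * X.card / (n : ℝ) ^ N := by
  obtain ⟨C₁, hC₁0, hC₁⟩ := exists_min_one_pow_div_factorial_le N
  obtain ⟨C₂, hC₂0, hC₂⟩ := exists_clustering_bound_of_commutator_bound hγ hΔγ N
  -- `M` bounds the balls of radius `R` and `J` is the Lieb–Robinson rate. The absolute value makes
  -- `J` nonnegative before any interaction is given.
  set M := ⌊c * (1 + (R : ℝ)) ^ d⌋₊ with hMdef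
  set J : ℝ := 2 ^ (M + 1) * |m| * M with hJ
  have hJ0 : 0 ≤ J := by positivity
  refine ⟨C₂ * (2 * C₁ * J * (1 + J) ^ N), by positivity, ?_⟩
  intro Λ _ _ G hG hgrowth h hh hH p hgap X Y A B hX hA hB n hn hsep v hv hv1
  have hM : ∀ x, (fattening G {x} R).card ≤ M := fun x => Nat.le_floor (hgrowth x R)
  have hdisj : Disjoint X Y := by
    refine Finset.disjoint_left.2 fun x hx hy => ?_
    have := hsep x hx x hy
    rw [SimpleGraph.dist_self] at this
    exact absurd this (Nat.not_le.2 (by positivity))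
  have hcard : (1 : ℝ) ≤ X.card := by exact_mod_cast hX.card_pos
  have hn0 : (0 : ℝ) < n := by exact_mod_cast hn
  refine (hC₂ hgap (hA.commute hdisj hB)
    (2 * C₁ * J * (1 + J) ^ N * ‖A‖ * ‖B‖ * X.card / (n : ℝ) ^ N) (fun t => ?_) v hv hv1).trans
    (le_of_eq (by ring))
  have hLR := lieb_robinson hG hh hH hM hX hA hB hsep t
  rw [← abs_of_nonneg hh.nonneg, ← hJ] at hLR
  have htriv : ‖A * evolve (Complex.I • hamiltonian h) B t -
      evolve (Complex.I • hamiltonian h) B t * A‖ ≤ 2 * ‖A‖ * ‖B‖ * X.card := by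
    refine (norm_commutator_le _ _).trans ?_
    rw [norm_evolve (I_smul_mem_skewAdjoint hH)]
    exact le_mul_of_one_le_right (by positivity) hcard
  calc ‖A * evolve (Complex.I • hamiltonian h) B t -
      evolve (Complex.I • hamiltonian h) B t * A‖
      ≤ 2 * ‖A‖ * ‖B‖ * X.card * min 1 ((J * |t|) ^ n / n.factorial) := by
        rw [mul_min_of_nonneg _ _ (by positivity), mul_one, ← mul_div_assoc]
        exact le_min htriv hLR
    _ ≤ 2 * ‖A‖ * ‖B‖ * X.card * (C₁ * (J * |t|) * (1 + J * |t|) ^ N / (n : ℝ) ^ N) := by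
        gcongr
        exact hC₁ _ _ (by positivity) hn
    _ ≤ 2 * ‖A‖ * ‖B‖ * X.card *
          (C₁ * (J * |t|) * ((1 + J) * (1 + |t|)) ^ N / (n : ℝ) ^ N) := by
        gcongr
        have := abs_nonneg t
        nlinarith
    _ = _ := by rw [mul_pow]; ring

section Correlation

variable {E : Type*} [NormedAddCommGroup E] [InnerProductSpace ℂ E] [FiniteDimensional ℂ E]
  {H : E →L[ℂ] E} {hH : IsSelfAdjoint H} {p : ℕ}

theorem norm_groundProjection_apply_le (v : E) : ‖groundProjection hH p v‖ ≤ ‖v‖ :=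
  Submodule.norm_starProjection_apply_le _ v

theorem norm_inner_sub_inner_groundProjection_le (A B : E →L[ℂ] E) {v : E} (hv : ‖v‖ = 1) :
    ‖inner ℂ v (A (B v)) - inner ℂ v (A (groundProjection hH p (B v)))‖ ≤ 2 * ‖A‖ * ‖B‖ := by
  have hB : ‖B v‖ ≤ ‖B‖ := by simpa [hv] using B.le_opNorm v
  have key : ∀ w : E, ‖w‖ ≤ ‖B‖ → ‖inner ℂ v (A w)‖ ≤ ‖A‖ * ‖B‖ := by
    intro w hw
    refine (norm_inner_le_norm _ _).trans ?_
    rw [hv, one_mul]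
    exact (A.le_opNorm w).trans (by gcongr)
  refine (norm_sub_le _ _).trans ?_
  have h1 := key _ hB
  have h2 := key _ ((norm_groundProjection_apply_le (hH := hH) (p := p) _).trans hB)
  linarith

theorem inner_sub_inner_groundProjection_eq_zero_of_left {A B : E →L[ℂ] E} {z : ℂ}
    (hA : A = z • 1) {v : E} (hv : v ∈ (groundProjection hH p).range) :
    inner ℂ v (A (B v)) - inner ℂ v (A (groundProjection hH p (B v))) = 0 := by
  have h : ∀ w, inner ℂ v (A w) = z * inner ℂ v w := fun w => by simp [hA]
  rw [h, h, inner_groundProjection_right, groundProjection_apply_of_mem_range hv, sub_self]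

theorem inner_sub_inner_groundProjection_eq_zero_of_right {A B : E →L[ℂ] E} {z : ℂ}
    (hB : B = z • 1) {v : E} (hv : v ∈ (groundProjection hH p).range) :
    inner ℂ v (A (B v)) - inner ℂ v (A (groundProjection hH p (B v))) = 0 := by
  have h : B v = z • v := by simp [hB]
  rw [h, map_smul, map_smul, groundProjection_apply_of_mem_range hv, map_smul, sub_self]

/-- The correlation is bilinear in the two operators, so it telescopes as (A - A', B) + (A', B - B')
+ (A', B'). -/
theorem norm_inner_sub_inner_groundProjection_approx_le (A B A' B' : E →L[ℂ] E) {v : E}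
    (hv : ‖v‖ = 1) :
    ‖inner ℂ v (A (B v)) - inner ℂ v (A (groundProjection hH p (B v)))‖ ≤
      2 * ‖A - A'‖ * ‖B‖ + 2 * ‖A'‖ * ‖B - B'‖ +
        ‖inner ℂ v (A' (B' v)) - inner ℂ v (A' (groundProjection hH p (B' v)))‖ := by
  have h1 := norm_inner_sub_inner_groundProjection_le (hH := hH) (p := p) (A - A') B hv
  have h2 := norm_inner_sub_inner_groundProjection_le (hH := hH) (p := p) A' (B - B') hv
  refine le_trans (le_of_eq ?_) ((norm_add₃_le).trans (add_le_add (add_le_add h1 h2) le_rfl))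
  congr 1
  simp only [_root_.sub_apply, map_sub, inner_sub_right]
  ring

end Correlation

/-- Bounds on approximants of an almost supported sequence. -/
theorem AlmostSupported.exists_approximants {K : SystemKind} {Λ : ℕ → Type*}
    [∀ L, Fintype (Λ L)] [∀ L, LinearOrder (Λ L)] {G : ∀ L, SimpleGraph (Λ L)}
    {Z : ∀ L, Finset (Λ L)} {A : ∀ L, Operators K.State (Λ L)} (hA : AlmostSupported K G Z A)
    (k : ℕ) : ∃ (A' : ∀ L, ℕ → Operators K.State (Λ L)) (C : ℝ), 0 ≤ C ∧
      (∀ L r, SupportedIn K (fattening (G L) (Z L) r) (A' L r)) ∧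
      (∀ L r, 1 ≤ r → ‖A L - A' L r‖ ≤ C * ‖A L‖ * (Z L).card / (r : ℝ) ^ k) ∧
      ∀ L r, 1 ≤ r → (Z L).Nonempty → ‖A' L r‖ ≤ (1 + C) * ‖A L‖ * (Z L).card := by
  obtain ⟨A', hsupp, hA'⟩ := hA
  obtain ⟨C, hC⟩ := hA' k
  have hC' : ∀ L r, 1 ≤ r → ‖A L - A' L r‖ ≤ |C| * ‖A L‖ * (Z L).card / (r : ℝ) ^ k := by
    intro L r hr
    refine (hC L r hr).trans ?_
    gcongr
    exact le_abs_self C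
  refine ⟨A', |C|, abs_nonneg C, hsupp, hC', fun L r hr hZ => ?_⟩
  have hcard : (1 : ℝ) ≤ (Z L).card := by exact_mod_cast hZ.card_pos
  have hr1 : (1 : ℝ) ≤ (r : ℝ) ^ k := one_le_pow₀ (by exact_mod_cast hr)
  have h1 : ‖A' L r‖ ≤ ‖A L‖ + ‖A L - A' L r‖ := by
    have := norm_sub_le (A L) (A L - A' L r)
    rwa [sub_sub_cancel] at this
  have h2 : |C| * ‖A L‖ * (Z L).card / (r : ℝ) ^ k ≤ |C| * ‖A L‖ * (Z L).card :=
    div_le_self (by positivity) hr1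
  have h3 : ‖A L‖ ≤ ‖A L‖ * (Z L).card := le_mul_of_one_le_right (norm_nonneg _) hcard
  have h4 := hC' L r hr
  linarith

/-- The error bound contains the factor |Z| = 0, so the operator equals an approximant supported in
the empty set. -/
theorem AlmostSupported.eq_smul_one {K : SystemKind} {Λ : ℕ → Type*}
    [∀ L, Fintype (Λ L)] [∀ L, LinearOrder (Λ L)] {G : ∀ L, SimpleGraph (Λ L)}
    {Z : ∀ L, Finset (Λ L)} {A : ∀ L, Operators K.State (Λ L)} (hA : AlmostSupported K G Z A)
    {L : ℕ} (hZ : Z L = ∅) : ∃ z : ℂ, A L = z • 1 := by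
  obtain ⟨A', hsupp, hA'⟩ := hA
  obtain ⟨C, hC⟩ := hA' 0
  have h1 := hC L 1 le_rfl
  rw [hZ, Finset.card_empty, Nat.cast_zero, mul_zero, zero_div] at h1
  have h2 : A L = A' L 1 := sub_eq_zero.1 (norm_le_zero_iff.1 h1)
  have h3 := hsupp L 1
  rw [hZ, fattening_empty] at h3
  rw [h2]
  exact h3.eq_smul_one

/-- Bookkeeping for the final estimate: `a`, `b` are the norms of the observables, `x`, `y` the
sizes of their sets, `δ₁`, `δ₂` the approximation errors, `α`, `β` the norms of the approximants and
`s` the size of the fattening. It is applied with `q = n ^ k` and `q' = n ^ (k + d)`. -/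
theorem approximation_error_le {a b x y δ₁ δ₂ α β s q q' C₁ C₂ F Q : ℝ} (ha : 0 ≤ a) (hb : 0 ≤ b)
    (hC₁ : 0 ≤ C₁) (hC₂ : 0 ≤ C₂) (hF : 0 ≤ F) (hx : 0 ≤ x) (hy : 1 ≤ y) (hq : 0 < q)
    (hq' : 0 < q') (hδ₂0 : 0 ≤ δ₂) (hβ0 : 0 ≤ β) (hs0 : 0 ≤ s)
    (hδ₁ : δ₁ ≤ C₁ * a * x / q) (hδ₂ : δ₂ ≤ C₂ * b * y / q)
    (hα : α ≤ (1 + C₁) * a * x) (hβ : β ≤ (1 + C₂) * b * y) (hs : s ≤ Q * q') :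
    2 * δ₁ * b + 2 * α * δ₂ + F * α * β * s / (q * q') ≤
      (2 * C₁ + 2 * (1 + C₁) * C₂ + F * (1 + C₁) * (1 + C₂) * Q) * a * b * x * y / q := by
  have t1 : 2 * δ₁ * b ≤ 2 * C₁ * a * b * x * y / q := by
    calc 2 * δ₁ * b ≤ 2 * (C₁ * a * x / q) * b := by gcongr
      _ ≤ 2 * (C₁ * a * x / q) * b * y := le_mul_of_one_le_right (by positivity) hy
      _ = _ := by ring
  have t2 : 2 * α * δ₂ ≤ 2 * (1 + C₁) * C₂ * a * b * x * y / q := by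
    calc 2 * α * δ₂ ≤ 2 * ((1 + C₁) * a * x) * (C₂ * b * y / q) := by gcongr
      _ = _ := by ring
  have t3 : F * α * β * s / (q * q') ≤ F * (1 + C₁) * (1 + C₂) * Q * a * b * x * y / q := by
    calc F * α * β * s / (q * q')
        ≤ F * ((1 + C₁) * a * x) * ((1 + C₂) * b * y) * (Q * q') / (q * q') := by gcongr
      _ = _ := by field_simp
  calc _ ≤ _ := add_le_add (add_le_add t1 t2) t3
    _ = _ := by ring

end Clustering

end ManyBody

/-! ### The clustering estimate for almost supported observables -/

open ManyBody in
theorem mainTheorem7 (K : SystemKind)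
    (Λ : ℕ → Type*) [∀ L, Fintype (Λ L)] [∀ L, LinearOrder (Λ L)]
    (G : ∀ L, SimpleGraph (Λ L)) (hconn : ∀ L, (G L).Connected)
    (c : ℝ) (d : ℕ) (hgrowth : ∀ L, BallGrowth (G L) c d)
    (R : ℕ) (m : ℝ) (h : ∀ L, Finset (Λ L) → Operators K.State (Λ L))
    (hh : ∀ L, IsFiniteRange K (G L) R m (h L))
    (hH : ∀ L, IsSelfAdjoint (hamiltonian (h L)))
    (p : ℕ) (γ Δ : ℝ) (hγ : 0 < γ) (hΔ : 0 < Δ) (hγΔ : 2 * Δ < γ)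
    (hgap : ∀ L, HasGap (hH L) p γ Δ)
    (X Y : ∀ L, Finset (Λ L)) (hXY : ∀ L, Disjoint (X L) (Y L))
    (A B : ∀ L, Operators K.State (Λ L))
    (hA : AlmostSupported K G X A) (hB : AlmostSupported K G Y B) :
    ∀ k : ℕ, ∃ C : ℝ, ∀ L, ∀ Ω ∈ (groundProjection (hH L) p).range, ‖Ω‖ = 1 →
      ‖inner ℂ Ω (A L (B L Ω)) - inner ℂ Ω (A L (groundProjection (hH L) p (B L Ω)))‖ ≤
        C * ‖A L‖ * ‖B L‖ * ((X L).card : ℝ) * ((Y L).card : ℝ) /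
          (setDist (G L) (X L) (Y L) : ℝ) ^ k := by
  intro k
  -- Of the decay exponent, `k` is the target, `d` pays for the volume growth of the fattening, and
  -- another `k` for a surplus factor |X|.
  obtain ⟨F, hF0, hF⟩ := exists_local_clustering_bound K c d R m hγ (by linarith : Δ < γ)
    (2 * k + d)
  obtain ⟨A', CA, hCA0, hA's, hA'd, hA'n⟩ := hA.exists_approximants k
  obtain ⟨B', CB, hCB0, hB's, hB'd, hB'n⟩ := hB.exists_approximants k
  set W : ℝ := 6 * ((R : ℝ) + 1) with hW
  have hW0 : 0 < W := by positivity
  set S : ℝ := 2 * CA + 2 * (1 + CA) * CB +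
    F * (1 + CA) * (1 + CB) * W ^ k * |c| * ((R : ℝ) + 2) ^ d with hS
  have hS0 : 0 ≤ S := by positivity
  have hW1 : 1 ≤ W := by rw [hW]; nlinarith [(Nat.cast_nonneg R : (0 : ℝ) ≤ R)]
  refine ⟨W ^ k * (2 + S), fun L Ω hΩ hΩ1 => ?_⟩
  rcases (X L).eq_empty_or_nonempty with hX | hX
  · obtain ⟨z, hz⟩ := hA.eq_smul_one hX
    rw [inner_sub_inner_groundProjection_eq_zero_of_left hz hΩ, hX]
    simp
  rcases (Y L).eq_empty_or_nonempty with hY | hY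
  · obtain ⟨z, hz⟩ := hB.eq_smul_one hY
    rw [inner_sub_inner_groundProjection_eq_zero_of_right hz hΩ, hY]
    simp
  have hx : (1 : ℝ) ≤ (X L).card := by exact_mod_cast hX.card_pos
  have hy : (1 : ℝ) ≤ (Y L).card := by exact_mod_cast hY.card_pos
  have hDpos : 0 < setDist (G L) (X L) (Y L) := setDist_pos (hconn L) hX hY (hXY L)
  set D := setDist (G L) (X L) (Y L) with hD
  set x : ℝ := ((X L).card : ℝ)
  set y : ℝ := ((Y L).card : ℝ)
  have hDpos' : (0 : ℝ) < (D : ℝ) ^ k := by positivity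
  have ha := norm_nonneg (A L)
  have hb := norm_nonneg (B L)
  -- At short distance, or for large |X|, the bound 2‖A‖‖B‖ already suffices.
  have htriv : (D : ℝ) ^ k ≤ W ^ k * x → ‖inner ℂ Ω (A L (B L Ω)) -
      inner ℂ Ω (A L (groundProjection (hH L) p (B L Ω)))‖ ≤
      W ^ k * (2 + S) * ‖A L‖ * ‖B L‖ * x * y / (D : ℝ) ^ k := by
    intro hle
    refine (norm_inner_sub_inner_groundProjection_le (A L) (B L) hΩ1).trans ?_
    rw [le_div_iff₀ hDpos']
    calc 2 * ‖A L‖ * ‖B L‖ * (D : ℝ) ^ k ≤ (2 + S) * ‖A L‖ * ‖B L‖ * (W ^ k * x * y) := by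
          gcongr
          · linarith
          · exact hle.trans (le_mul_of_one_le_right (by positivity) hy)
      _ = _ := by ring
  -- The distance is split in three: two parts for the fattenings of radius n(R + 1), one for the
  -- separation left between them.
  set n := D / (3 * (R + 1)) with hn
  have hDlt : (D : ℝ) ≤ (n + 1) * (3 * ((R : ℝ) + 1)) := by
    have h1 : D < 3 * (R + 1) * (n + 1) := Nat.lt_mul_div_succ D (by positivity)
    have h2 : (D : ℝ) < 3 * (R + 1) * (n + 1) := by exact_mod_cast h1
    linarith
  rcases Nat.eq_zero_or_pos n with hn0 | hn0
  · refine htriv ?_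
    rw [hn0] at hDlt
    calc (D : ℝ) ^ k ≤ W ^ k := by
          gcongr
          refine hDlt.trans ?_
          rw [hW]
          push_cast
          nlinarith [(Nat.cast_nonneg R : (0 : ℝ) ≤ R)]
      _ ≤ W ^ k * x := le_mul_of_one_le_right (by positivity) hx
  -- |X| enters twice, through the norm of the approximant and the size of the fattening, but the
  -- claim allows it once. In the nontrivial case the second copy is at most D^k.
  rcases le_total ((D : ℝ) ^ k) x with hxD | hxD
  · exact htriv (hxD.trans (le_mul_of_one_le_left (by positivity) (one_le_pow₀ hW1)))
  have hn1 : (1 : ℝ) ≤ n := by exact_mod_cast hn0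
  have hDW : (D : ℝ) ≤ W * n := by
    refine hDlt.trans ?_
    rw [hW]
    nlinarith [(Nat.cast_nonneg R : (0 : ℝ) ≤ R)]
  have hDk : (D : ℝ) ^ k ≤ W ^ k * (n : ℝ) ^ k := by
    rw [← mul_pow]
    gcongr
  set r := n * (R + 1) with hr
  have hnr : n ≤ r := Nat.le_mul_of_pos_right n (by positivity)
  have hr1 : 1 ≤ r := hn0.trans_le hnr
  have hrD : 3 * r ≤ D := by
    have := Nat.div_mul_le_self D (3 * (R + 1))
    rw [← hn] at this
    calc 3 * r = n * (3 * (R + 1)) := by rw [hr]; ring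
      _ ≤ D := this
  have hsep : ∀ u ∈ fattening (G L) (X L) r, ∀ w ∈ fattening (G L) (Y L) r,
      n * (R + 1) ≤ (G L).dist u w := by
    intro u hu w hw
    have := setDist_le_dist_of_mem_fattening (hconn L) hu hw
    omega
  have hlocal := hF (hconn L) (hgrowth L) (hh L) (hgap L) (hX.mono (subset_fattening _ _ r))
    (hA's L r) (hB's L r) hn0 hsep Ω hΩ hΩ1
  have hrk : (n : ℝ) ^ k ≤ (r : ℝ) ^ k := by gcongr
  have hnk : (0 : ℝ) < (n : ℝ) ^ k := by positivity
  have hAd : ‖A L - A' L r‖ ≤ CA * ‖A L‖ * x / (n : ℝ) ^ k :=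
    (hA'd L r hr1).trans (by gcongr)
  have hBd : ‖B L - B' L r‖ ≤ CB * ‖B L‖ * y / (n : ℝ) ^ k :=
    (hB'd L r hr1).trans (by gcongr)
  have hAn := hA'n L r hr1 hX
  have hBn := hB'n L r hr1 hY
  have hcard : ((fattening (G L) (X L) r).card : ℝ) ≤
      W ^ k * |c| * ((R : ℝ) + 2) ^ d * (n : ℝ) ^ (k + d) := by
    calc ((fattening (G L) (X L) r).card : ℝ) ≤ x * (c * (1 + r) ^ d) :=
          (hgrowth L).card_fattening_le _ _
      _ ≤ x * (|c| * (1 + r) ^ d) := by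
          gcongr
          exact le_abs_self c
      _ ≤ (W ^ k * (n : ℝ) ^ k) * (|c| * (((R : ℝ) + 2) * n) ^ d) := by
          have h1 : 1 + (r : ℝ) ≤ ((R : ℝ) + 2) * n := by
            rw [hr]
            push_cast
            linarith
          have h2 := hxD.trans hDk
          gcongr
      _ = W ^ k * |c| * ((R : ℝ) + 2) ^ d * (n : ℝ) ^ (k + d) := by
          rw [mul_pow ((R : ℝ) + 2), pow_add]
          ring
  have hmain : ‖inner ℂ Ω (A L (B L Ω)) -
      inner ℂ Ω (A L (groundProjection (hH L) p (B L Ω)))‖ ≤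
      S * ‖A L‖ * ‖B L‖ * x * y / (n : ℝ) ^ k := by
    refine (norm_inner_sub_inner_groundProjection_approx_le (A L) (B L) (A' L r) (B' L r)
      hΩ1).trans ?_
    refine le_trans (add_le_add le_rfl hlocal) ?_
    have hpow : (n : ℝ) ^ (2 * k + d) = (n : ℝ) ^ k * (n : ℝ) ^ (k + d) := by
      rw [← pow_add]
      congr 1
      ring
    rw [hpow]
    refine (approximation_error_le ha hb hCA0 hCB0 hF0 (by linarith) hy hnk (by positivity)
      (norm_nonneg _) (norm_nonneg _) (Nat.cast_nonneg _)
      hAd hBd hAn hBn hcard).trans_eq ?_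
    rw [hS]
    simp only [mul_assoc]
  refine hmain.trans ?_
  rw [div_le_div_iff₀ hnk hDpos']
  calc S * ‖A L‖ * ‖B L‖ * x * y * (D : ℝ) ^ k
      ≤ (2 + S) * ‖A L‖ * ‖B L‖ * x * y * (W ^ k * (n : ℝ) ^ k) := by
        gcongr
        linarith
    _ = _ := by ring
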